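/- **Setting.** Consider the honeycomb lattice in $\mathbb R^2$ with sides of length $1$, a spin $\mathbb C^2$ on each edge, and the resulting C*-algebra $\mathcal A$ of quasi-local observables; $\mathcal A_X$ is the C*-subalgebra generated by the Pauli matrices $\sigma^X_x,\sigma^Z_x$ of the edges $x$ with midpoint in $X\subset\mathbb R^2$. An automorphism $w$ of $\mathcal A$ is supported in $X$ if it is the identity on $\mathcal A_{X^c}$. Edges with $\sigma^Z=-1$ are regarded as occupied by a string. Let $\omega_0$ be the product state with $\omega_0(\sigma^Z_x)=1$ for all $x$, with GNS vector $\Omega_0$. For a finite set $\Pi$ of hexagons let $A_\Pi=\prod_{x\in\partial\Pi}\sigma^X_x$, and let $\sharp\Pi$ be the number of connected components of the string configuration $\partial\Pi$. For an increasing sequence $\Pi_n$ of finite sets of hexagons exhausting the lattice let $\omega_n$ be the vector state on $\mathcal A$ of $$\Omega_n=2^{-|\Pi_n|/2}\sum_{\Pi\subset\Pi_n}(-1)^{\sharp\Pi}A_\Pi\Omega_0 .$$ Let $\omega$ be the double semion state, i.e. the weak-* limit of $\omega_n$ (more generally, $\omega$ may be any weak-* limit point of such a sequence). Let $\pi_1$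 be its GNS representation, and $\mathcal R(X)=\pi_1(\mathcal A_X)''$. **Strings.** For an oriented path $P$ of lattice edges, the R-legs are the edges attached to $P$ from the right at vertices between consecutive edges of $P$, and the L-vertices are the vertices between consecutive edges of $P$ at which the third edge lies on the left. Put $I=\{1,S,\bar S,B\}$, $W_1[P]=\mathbb 1$, $W_B[P]=\prod_{\text{R-legs }j}\sigma^Z_j$, $$W_S[P]=\Big(\prod_{j\in P}\sigma^X_j\Big)\Big(\prod_{\text{R-legs }j} i^{(1-\sigma^Z_j)/2}\Big)\Big(\prod_{\text{L-vertices }v}(-1)^{s_v}\Big),\qquad s_v=\tfrac14(1-\sigma^Z_j)(1+\sigma^Z_k),$$ where $j$ and $k$ are the edges of $P$ going into and out of $v$, and let $W_{\bar S}[P]$ be the same expression with $-i$ in place of $i$. Let $w_a[P]$ be the automorphism of $\mathcal A$ given by conjugation with the (possibly formal) unitary $W_a[P]$. **Cones.** The cone with apex $x_0$, axis $\hat v$ (a unit vector) and opening angle $\theta\in(0,2\pi)$ is $\Lambda=\{x : (x-x_0)\cdot\hat v>\|x-x_0\|\cos(\theta/2)\}$. Let $\Lambda^{(R)}$ be its right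 half-cone, whose left leg is the axis of $\Lambda$, and let $\Pi_{\Lambda^{(R)}}$ be the set of open hexagons that meet $\Lambda^{(R)}$, its boundary being oriented counterclockwise. For $n>2$ let $P^{(n)}$ be the part of $\partial\Pi_{\Lambda^{(R)}}$ that follows the left leg of $\Lambda^{(R)}$ and consists of edges with midpoint at distance more than $n$ from $x_0$. Call $n>2$ admissible for $\Lambda$ if $w_a[P^{(n)}]$ is supported in $\Lambda$ for all $a\in I$, and then put $w_{a,\Lambda}=w_a[P^{(n)}]$. **Proposition.** For each cone $\Lambda$ all sufficiently large $n$ are admissible. For each cone $\Lambda$ and each admissible $n$ there are unitaries $\Omega(a,b)\in\mathcal R(\Lambda)$, $a,b\in I$, such that $$\mathrm{Ad}(\Omega(a,b))\circ\pi_1\circ w_{a,\Lambda}\circ w_{b,\Lambda}=\pi_1\circ w_{a\times b,\Lambda}\qquad\text{for all }a,b\in I,$$ where $\times$ is the abelian product on $I$ with unit $1$ given by $$S\times S=\bar S\times\bar S=B\times B=1,\quad S\times\bar S=B,\quad S\times B=\bar S,\quad \bar S\times B=S .$$ -/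

import Mathlib

noncomputable section

open Filter Topology
open scoped symmDiff

namespace DoubleSemion

/-! ### Infinite products of commuting local unitaries

Let `A` be a C*-algebra topologically generated by `G`, and `u i` a family of commuting unitaries
such that each generator commutes with all but finitely many of them. Conjugation with the formal
product `∏ i, u i` is the automorphism `O ↦ lim_T Ad(∏_{i ∈ T} u i) O` of `A`. -/

section FormalAd

variable {A : Type*} [CStarAlgebra A] {ι : Type*}

/-- The finite partial product of a family of commuting unitaries. -/
def partialProd (u : ι → unitary A) (hu : ∀ i j, Commute (u i) (u j)) (T : Finset ι) :
    unitary A :=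
  T.noncommProd u (fun i _ j _ _ => hu i j)

/-- Conjugation `O ↦ U O U*` with a unitary of the algebra. -/
def conj (U : unitary A) (O : A) : A := (U : A) * O * star (U : A)

theorem conj_isometry (U : unitary A) (x y : A) : ‖conj U x - conj U y‖ = ‖x - y‖ := by
  have h : conj U x - conj U y = (U : A) * (x - y) * ((star U : unitary A) : A) := by
    simp [conj, mul_sub, sub_mul]
  rw [h, CStarRing.norm_mul_coe_unitary, CStarRing.norm_coe_unitary_mul]

theorem conj_conj_star (U : unitary A) (x : A) : conj U (conj (star U) x) = x := by
  simp only [conj, Unitary.coe_star, star_star]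
  rw [show (U : A) * (star (U : A) * x * U) * star (U : A)
    = ((U : A) * star (U : A)) * x * ((U : A) * star (U : A)) by noncomm_ring]
  simp

theorem conj_star_conj (U : unitary A) (x : A) : conj (star U) (conj U x) = x := by
  simpa using conj_conj_star (star U) x

theorem conj_mul (U V : unitary A) (x : A) : conj (U * V) x = conj U (conj V x) := by
  simp [conj, mul_assoc]

theorem conj_of_commute (U : unitary A) (x : A) (h : Commute (U : A) x) : conj U x = x := by
  simp only [conj]
  rw [h.eq, mul_assoc]
  simp

/-- The elements on which conjugation with the partial products converges. -/
def convSet (U : Finset ι → unitary A) : Set A :=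
  {x | ∃ y, Tendsto (fun T => conj (U T) x) atTop (𝓝 y)}

theorem convSet_closed (U : Finset ι → unitary A) : IsClosed (convSet U) := by
  classical
  rw [← isSeqClosed_iff_isClosed]
  intro x a hx ha
  have hC : Cauchy (map (fun T => conj (U T) a) atTop) := by
    rw [Metric.cauchy_iff]
    refine ⟨inferInstance, fun ε hε => ?_⟩
    obtain ⟨n, hn⟩ := (Metric.tendsto_atTop.1 ha (ε / 4) (by positivity))
    have hn := hn n le_rfl
    obtain ⟨y, hy⟩ := hx n
    have := (Metric.tendsto_nhds.1 hy) (ε / 4) (by positivity)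
    refine ⟨_, image_mem_map this, ?_⟩
    rintro _ ⟨S, hS, rfl⟩ _ ⟨T, hT, rfl⟩
    have key : ∀ R : Finset ι, dist (conj (U R) (x n)) y < ε / 4 →
        dist (conj (U R) a) y < ε / 2 := by
      intro R hR
      have h1 : dist (conj (U R) a) (conj (U R) (x n)) < ε / 4 := by
        rw [dist_eq_norm, conj_isometry, ← dist_eq_norm, dist_comm]; exact hn
      linarith [dist_triangle (conj (U R) a) (conj (U R) (x n)) y]
    have h1 := key S hS
    have h2 := key T hT
    linarith [dist_triangle_right (conj (U S) a) (conj (U T) a) y]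
  exact CompleteSpace.complete hC

/-- `convSet` as a star subalgebra. -/
def convAlg (U : Finset ι → unitary A) : StarSubalgebra ℂ A where
  carrier := convSet U
  mul_mem' := by
    rintro a b ⟨y, hy⟩ ⟨z, hz⟩
    refine ⟨y * z, (hy.mul hz).congr fun T => ?_⟩
    simp only [conj]
    rw [show (U T : A) * a * star (U T : A) * ((U T : A) * b * star (U T : A))
      = (U T : A) * a * (star (U T : A) * (U T : A)) * b * star (U T : A) by noncomm_ring]
    simp [mul_assoc]
  add_mem' := by
    rintro a b ⟨y, hy⟩ ⟨z, hz⟩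
    refine ⟨y + z, (hy.add hz).congr fun T => ?_⟩
    simp [conj, mul_add, add_mul]
  algebraMap_mem' := by
    intro r
    refine ⟨algebraMap ℂ A r, tendsto_const_nhds.congr fun T => ?_⟩
    exact (conj_of_commute _ _ (Algebra.commutes r _).symm).symm
  star_mem' := by
    rintro a ⟨y, hy⟩
    refine ⟨star y, (hy.star).congr fun T => ?_⟩
    simp [conj, mul_assoc]

theorem conj_partialProd_tendsto (u : ι → unitary A) (hu : ∀ i j, Commute (u i) (u j))
    (G : Set A) (hG : (StarAlgebra.adjoin ℂ G).topologicalClosure = ⊤)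
    (hloc : ∀ g ∈ G, {i | ¬ Commute (u i : A) g}.Finite) (x : A) :
    ∃ y, Tendsto (fun T => conj (partialProd u hu T) x) atTop (𝓝 y) := by
  classical
  have hgen : G ⊆ (convAlg (partialProd u hu) : Set A) := by
    intro g hg
    refine ⟨conj (partialProd u hu (hloc g hg).toFinset) g, ?_⟩
    refine tendsto_const_nhds.congr' ?_
    filter_upwards [eventually_ge_atTop (hloc g hg).toFinset] with T hT
    have hs : partialProd u hu T = partialProd u hu (hloc g hg).toFinset *
        partialProd u hu (T \ (hloc g hg).toFinset) := by
      unfold partialProd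
      rw [← Finset.noncommProd_union_of_disjoint Finset.disjoint_sdiff u
        (fun i _ j _ _ => hu i j)]
      exact Finset.noncommProd_congr (Finset.union_sdiff_of_subset hT).symm
        (fun _ _ => rfl) _
    rw [hs, conj_mul, conj_of_commute (partialProd u hu (T \ (hloc g hg).toFinset)) g]
    have hm : ∀ (S : Finset ι), (∀ i ∈ S, Commute (u i : A) g) →
        Commute (partialProd u hu S : A) g := by
      intro S hS
      refine Finset.noncommProd_induction S u (fun i _ j _ _ => hu i j)
        (fun V : unitary A => Commute (V : A) g) ?_ ?_ hS
      · intro a b ha hb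
        exact Commute.mul_left ha hb
      · exact Commute.one_left g
    refine hm _ fun i hi => ?_
    simpa using (Finset.mem_sdiff.1 hi).2
  have hle : (StarAlgebra.adjoin ℂ G).topologicalClosure ≤ convAlg (partialProd u hu) :=
    StarSubalgebra.topologicalClosure_minimal (StarAlgebra.adjoin_le hgen) (convSet_closed _)
  rw [hG] at hle
  exact hle (StarSubalgebra.mem_top)

/-- The limit `lim_T Ad(∏_{i ∈ T} u i) O`. -/
def formalConj (u : ι → unitary A) (hu : ∀ i j, Commute (u i) (u j)) (O : A) : A :=
  limUnder atTop (fun T => conj (partialProd u hu T) O)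

theorem star_comm {u : ι → unitary A} (hu : ∀ i j, Commute (u i) (u j)) (i j : ι) :
    Commute (star (u i)) (star (u j)) := by
  have h := hu j i
  change star (u i) * star (u j) = star (u j) * star (u i)
  rw [← star_mul, ← star_mul, h.eq]

theorem partialProd_empty (u : ι → unitary A) (hu : ∀ i j, Commute (u i) (u j)) :
    partialProd u hu ∅ = 1 :=
  Finset.noncommProd_empty _ _

theorem partialProd_insert [DecidableEq ι] (u : ι → unitary A)
    (hu : ∀ i j, Commute (u i) (u j)) (a : ι) (T : Finset ι) (ha : a ∉ T) :
    partialProd u hu (insert a T) = u a * partialProd u hu T :=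
  Finset.noncommProd_insert_of_notMem _ _ _ _ ha

theorem partialProd_insert' [DecidableEq ι] (u : ι → unitary A)
    (hu : ∀ i j, Commute (u i) (u j)) (a : ι) (T : Finset ι) (ha : a ∉ T) :
    partialProd u hu (insert a T) = partialProd u hu T * u a :=
  Finset.noncommProd_insert_of_notMem' _ _ _ _ ha

theorem partialProd_star (u : ι → unitary A) (hu : ∀ i j, Commute (u i) (u j))
    (T : Finset ι) :
    partialProd (fun i => star (u i)) (star_comm hu) T = star (partialProd u hu T) := by
  classical
  induction T using Finset.induction_on with
  | empty => simp [partialProd_empty]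
  | insert a s ha ih =>
    rw [partialProd_insert _ _ _ _ ha, partialProd_insert' _ _ _ _ ha, star_mul, ih]

/-- Conjugation with the formal product `∏ i, u i` of commuting unitaries, as an automorphism. -/
def formalAd (u : ι → unitary A) (hu : ∀ i j, Commute (u i) (u j))
    (G : Set A) (hG : (StarAlgebra.adjoin ℂ G).topologicalClosure = ⊤)
    (hloc : ∀ g ∈ G, {i | ¬ Commute (u i : A) g}.Finite) : A ≃⋆ₐ[ℂ] A :=
  have hT : ∀ x, Tendsto (fun T => conj (partialProd u hu T) x) atTop
      (𝓝 (formalConj u hu x)) := fun x =>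
    tendsto_nhds_limUnder (conj_partialProd_tendsto u hu G hG hloc x)
  have hloc' : ∀ g ∈ G, {i | ¬ Commute ((star (u i) : unitary A) : A) g}.Finite := by
    intro g hg
    refine (hloc g hg).subset fun i hi h => hi ?_
    have h2 := conj_of_commute _ _ h
    have h3 := conj_star_conj (u i) g
    rw [h2] at h3
    simp only [conj, Unitary.coe_star, star_star] at h3
    change star (u i : A) * g = g * star (u i : A)
    conv_rhs => rw [← h3]
    rw [mul_assoc, mul_assoc]
    simp
  have hT' : ∀ x, Tendsto (fun T => conj (star (partialProd u hu T)) x) atTop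
      (𝓝 (formalConj (fun i => star (u i)) (star_comm hu) x)) := fun x => by
    have e : (fun T => conj (star (partialProd u hu T)) x) =
        fun T => conj (partialProd (fun i => star (u i)) (star_comm hu) T) x := by
      funext T
      rw [partialProd_star]
    rw [e]
    exact tendsto_nhds_limUnder
      (conj_partialProd_tendsto (fun i => star (u i)) (star_comm hu) G hG hloc' x)
  { toFun := formalConj u hu
    invFun := formalConj (fun i => star (u i)) (star_comm hu)
    left_inv := by
      intro x
      refine tendsto_nhds_unique (hT' (formalConj u hu x)) ?_
      rw [tendsto_iff_norm_sub_tendsto_zero]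
      refine (tendsto_iff_norm_sub_tendsto_zero.1 (hT x)).congr fun T => ?_
      rw [← conj_isometry (star (partialProd u hu T)), conj_star_conj, norm_sub_rev]
    right_inv := by
      intro x
      refine tendsto_nhds_unique (hT (formalConj (fun i => star (u i)) (star_comm hu) x)) ?_
      rw [tendsto_iff_norm_sub_tendsto_zero]
      refine (tendsto_iff_norm_sub_tendsto_zero.1 (hT' x)).congr fun T => ?_
      rw [← conj_isometry (partialProd u hu T), conj_conj_star, norm_sub_rev]
    map_mul' := by
      intro x y
      refine tendsto_nhds_unique (hT (x * y)) (((hT x).mul (hT y)).congr fun T => ?_)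
      simp only [conj]
      rw [show ((partialProd u hu T : unitary A) : A) * x * star (partialProd u hu T : A) *
        ((partialProd u hu T : A) * y * star (partialProd u hu T : A))
        = (partialProd u hu T : A) * x * (star (partialProd u hu T : A) *
          (partialProd u hu T : A)) * y * star (partialProd u hu T : A) by noncomm_ring]
      simp [mul_assoc]
    map_add' := by
      intro x y
      refine tendsto_nhds_unique (hT (x + y)) (((hT x).add (hT y)).congr fun T => ?_)
      simp [conj, mul_add, add_mul]
    map_star' := by
      intro x
      refine tendsto_nhds_unique (hT (star x)) (((hT x).star).congr fun T => ?_)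
      simp [conj, mul_assoc]
    map_smul' := by
      intro c x
      refine tendsto_nhds_unique (hT (c • x)) (((hT x).const_smul c).congr fun T => ?_)
      simp [conj] }

theorem formalAd_tendsto (u : ι → unitary A) (hu : ∀ i j, Commute (u i) (u j))
    (G : Set A) (hG : (StarAlgebra.adjoin ℂ G).topologicalClosure = ⊤)
    (hloc : ∀ g ∈ G, {i | ¬ Commute (u i : A) g}.Finite) (x : A) :
    Tendsto (fun T => conj (partialProd u hu T) x) atTop (𝓝 (formalAd u hu G hG hloc x)) :=
  tendsto_nhds_limUnder (conj_partialProd_tendsto u hu G hG hloc x)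

end FormalAd

/-! ### The hexagonal lattice -/

/-- The plane `ℝ²` with its Euclidean structure. -/
abbrev Plane : Type := EuclideanSpace ℝ (Fin 2)

/-- Hexagons of the honeycomb lattice, in coordinates with respect to the triangular lattice of
their centers. -/
abbrev Hex : Type := ℤ × ℤ

/-- The displacements to the six neighbouring hexagons, in counterclockwise order. -/
def dir : Fin 6 → Hex
  | 0 => (1, 0)
  | 1 => (0, 1)
  | 2 => (-1, 1)
  | 3 => (-1, 0)
  | 4 => (0, -1)
  | 5 => (1, -1)

/-- Centers of the hexagons; the hexagons have side length `1`, so neighbouring centers are at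
distance `√3`. -/
def center (p : Hex) : Plane :=
  !₂[√3 * p.1 + √3 / 2 * p.2, 3 / 2 * p.2]

/-- The open regular hexagon `p` as a subset of the plane: the points lying strictly on the side
of `p` of the six perpendicular bisectors between its center and the neighbouring centers. -/
def hexagon (p : Hex) : Set Plane :=
  {x | ∀ i : Fin 6, inner ℝ (x - center p) (center (p + dir i) - center p) < 3 / 2}

/-- The sites of the system are the edges of the honeycomb lattice. The edge `(p, i)` is the common
side of the hexagons `p` and `p + dir i`; since `dir (i + 3) = - dir i`, the values `i = 0, 1, 2`
give every edge exactly once. -/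
abbrev Edge : Type := Hex × Fin 3

/-- The position of a site: the midpoint of the edge. -/
def Edge.pos (e : Edge) : Plane :=
  midpoint ℝ (center e.1) (center (e.1 + dir (Fin.castLE (by norm_num) e.2)))

/-- Oriented edges. `(p, i)` is the common side of `p` and `p + dir i`, oriented counterclockwise
around `p`, so `p` is on its left and `p + dir i` is on its right. -/
abbrev Dart : Type := Hex × Fin 6

namespace Dart

/-- The hexagon to the left of an oriented edge. -/
def left (d : Dart) : Hex := d.1

/-- The hexagon to the right of an oriented edge. -/
def right (d : Dart) : Hex := d.1 + dir d.2

/-- The hexagon in front of an oriented edge, i.e. the third hexagon at its final vertex. -/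
def ahead (d : Dart) : Hex := d.1 + dir (d.2 + 1)

/-- The edge of the lattice common to the hexagons `p` and `p + dir i`. -/
def edgeOf (p : Hex) : Fin 6 → Edge
  | 0 => (p, 0)
  | 1 => (p, 1)
  | 2 => (p, 2)
  | 3 => (p + dir 3, 0)
  | 4 => (p + dir 4, 1)
  | 5 => (p + dir 5, 2)

/-- The underlying unoriented edge. -/
def edge (d : Dart) : Edge := edgeOf d.1 d.2

/-- The oriented edge that follows `d` when turning left at its final vertex: it has `d.left` on its
left and `d.ahead` on its right. -/
def turnLeft (d : Dart) : Dart := (d.left, d.2 + 1)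

/-- The oriented edge that follows `d` when turning right at its final vertex: it has `d.ahead` on
its left and `d.right` on its right. -/
def turnRight (d : Dart) : Dart := (d.ahead, d.2 - 1)

theorem turnLeft_left (d : Dart) : d.turnLeft.left = d.left := rfl

theorem turnLeft_right (d : Dart) : d.turnLeft.right = d.ahead := rfl

theorem turnRight_left (d : Dart) : d.turnRight.left = d.ahead := rfl

theorem turnRight_right (d : Dart) : d.turnRight.right = d.right := by
  obtain ⟨p, i⟩ := d
  fin_cases i <;> simp only [turnRight, right, ahead, add_assoc] <;> congr 1

end Dart

/-- The oriented boundary of a set of hexagons: the oriented edges with a hexagon of the set on their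
left and a hexagon not in the set on their right, so that the boundary is traversed
counterclockwise. -/
def boundary (Q : Set Hex) : Set Dart := {d | d.left ∈ Q ∧ d.right ∉ Q}

/-- The unoriented boundary edges of a finite set of hexagons. -/
def boundaryEdges (Q : Finset Hex) : Finset Edge :=
  ((Q ×ˢ (Finset.univ : Finset (Fin 6))).filter fun d : Dart => d.right ∉ Q).image Dart.edge

/-- Two distinct edges of the lattice are adjacent if they share a vertex. -/
def edgeGraph : SimpleGraph Edge :=
  SimpleGraph.fromRel fun e f =>
    ∃ d : Dart, d.edge = e ∧ (d.turnLeft.edge = f ∨ d.turnRight.edge = f)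

/-- The number of connected components of the string configuration `∂Q`. -/
def numStrings (Q : Finset Hex) : ℕ :=
  Nat.card (edgeGraph.induce (boundaryEdges Q : Set Edge)).ConnectedComponent

/-! ### Cones -/

/-- Counterclockwise rotation of the plane by the angle `t`. -/
def rotate (t : ℝ) (v : Plane) : Plane :=
  !₂[Real.cos t * v 0 - Real.sin t * v 1, Real.sin t * v 0 + Real.cos t * v 1]

theorem norm_rotate (t : ℝ) (v : Plane) : ‖rotate t v‖ = ‖v‖ := by
  rw [EuclideanSpace.norm_eq, EuclideanSpace.norm_eq]
  congr 1
  simp only [rotate, Fin.sum_univ_two, Real.norm_eq_abs, sq_abs]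
  simp
  nlinarith [Real.sin_sq_add_cos_sq t]

/-- The data of a cone: its apex, its axis (a unit vector) and its opening angle in `(0, 2π)`. -/
structure Cone where
  apex : Plane
  axis : Plane
  angle : ℝ
  norm_axis : ‖axis‖ = 1
  angle_pos : 0 < angle
  angle_lt : angle < 2 * Real.pi

namespace Cone

/-- The cone as a subset of the plane. -/
def region (c : Cone) : Set Plane :=
  {x | inner ℝ (x - c.apex) c.axis > ‖x - c.apex‖ * Real.cos (c.angle / 2)}

/-- The sites in the cone. -/
def sites (c : Cone) : Set Edge := {e | e.pos ∈ c.region}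

/-- The right half `Λ^(R)` of a cone: same apex, half the opening angle, and its left leg is the axis
of the cone. -/
def rightHalf (c : Cone) : Cone where
  apex := c.apex
  axis := rotate (-(c.angle / 4)) c.axis
  angle := c.angle / 2
  norm_axis := by rw [norm_rotate, c.norm_axis]
  angle_pos := by have := c.angle_pos; positivity
  angle_lt := by have := c.angle_lt; have := c.angle_pos; linarith

/-- The set of hexagons which overlap with the cone. -/
def hexes (c : Cone) : Set Hex := {p | (hexagon p ∩ c.region).Nonempty}

/-- The part of the oriented boundary of the set of hexagons overlapping with the cone that follows
the left leg of the cone, and consists of the edges whose center is at distance more than `n` from the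
apex. For cones with opening angle less than `π` and `n > 2`, the boundary edges with center
`x` at distance more than `n` from the apex follow the left or the right leg of the cone, according
to whether `x` is to the left or to the right of the line through the axis; this is the sign of the
determinant of the axis and `x - apex`. -/
def leftPath (c : Cone) (n : ℝ) : Set Dart :=
  {d ∈ boundary c.hexes | n < dist d.edge.pos c.apex ∧
    0 < c.axis 0 * (d.edge.pos - c.apex) 1 - c.axis 1 * (d.edge.pos - c.apex) 0}

end Cone

/-! ### The quasi-local algebra

The quasi-local algebra of the spin system with a `ℂ²` at every site is realized in the (faithful)
GNS representation of the product state without strings: the Hilbert space has an orthonormal basis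
labelled by the finite sets of edges that are occupied by a string. -/

/-- String configurations with finitely many occupied edges. -/
abbrev Config : Type := Finset Edge

/-- The Hilbert space `ℓ²` over string configurations. -/
abbrev Fock : Type := lp (fun _ : Config => ℂ) 2

/-- The operator `(T ψ)(s) = f s * ψ (e s)` for a bijection `e` of configurations and phases `f`. -/
def monomialOp (e : Equiv.Perm Config) (f : Config → ℂ) (hf : ∀ s, ‖f s‖ = 1) :
    Fock →L[ℂ] Fock :=
  LinearMap.mkContinuous
    { toFun := fun ψ => ⟨fun s => f s * ψ (e s), by
        have h := (lp.memℓp ψ)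
        change Memℓp (fun s => f s * ψ (e s)) 2
        rw [memℓp_gen_iff (by norm_num)] at h ⊢
        simp only [norm_mul, hf, one_mul]
        exact (e.summable_iff (f := fun s => ‖ψ s‖ ^ (2 : ENNReal).toReal)).2 h⟩
      map_add' := fun ψ χ => by
        ext s
        exact mul_add (f s) (ψ (e s)) (χ (e s))
      map_smul' := fun c ψ => by
        ext s
        exact mul_left_comm (f s) c (ψ (e s)) }
    1 fun ψ => by
      rw [one_mul]
      refine le_of_eq ?_
      rw [lp.norm_eq_tsum_rpow (by norm_num), lp.norm_eq_tsum_rpow (by norm_num)]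
      congr 1
      simp only [LinearMap.coe_mk, AddHom.coe_mk, norm_mul, hf, one_mul]
      exact e.tsum_eq (fun s => ‖ψ s‖ ^ (2 : ENNReal).toReal)

@[simp]
theorem monomialOp_apply (e : Equiv.Perm Config) (f : Config → ℂ) (hf : ∀ s, ‖f s‖ = 1)
    (ψ : Fock) (s : Config) : monomialOp e f hf ψ s = f s * ψ (e s) := rfl

/-- Flipping the occupation of the edge `x`. -/
def flipEdge (x : Edge) : Equiv.Perm Config where
  toFun s := s ∆ {x}
  invFun s := s ∆ {x}
  left_inv s := by simp
  right_inv s := by simp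

/-- The Pauli matrix `σ^X_x`: flips the occupation of the edge `x`. -/
def opX (x : Edge) : Fock →L[ℂ] Fock := monomialOp (flipEdge x) (fun _ => 1) (by simp)

/-- The Pauli matrix `σ^Z_x`: it is `-1` if the edge `x` is occupied and `1` otherwise. -/
def opZ (x : Edge) : Fock →L[ℂ] Fock :=
  monomialOp (Equiv.refl _) (fun s => if x ∈ s then -1 else 1) (by intro s; split_ifs <;> simp)

/-- The Pauli matrices of the sites in `X`; for each site they generate the `2 × 2` matrices. -/
def paulis (X : Set Edge) : Set (Fock →L[ℂ] Fock) := opX '' X ∪ opZ '' X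

/-- The norm closed algebra generated by the Pauli matrices of the sites in `X`. -/
def opAlg (X : Set Edge) : StarSubalgebra ℂ (Fock →L[ℂ] Fock) :=
  (StarAlgebra.adjoin ℂ (paulis X)).topologicalClosure

/-- The algebra `𝒜` of quasi-local observables. -/
def QLoc : Type := opAlg Set.univ

instance : IsClosed (opAlg Set.univ : Set (Fock →L[ℂ] Fock)) :=
  StarSubalgebra.isClosed_topologicalClosure _

instance : CStarAlgebra QLoc := inferInstanceAs (CStarAlgebra (opAlg Set.univ))

/-- The order of the C*-algebra `𝒜`: the positive elements are the `star O * O`. -/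
instance : PartialOrder QLoc := CStarAlgebra.spectralOrder QLoc

instance : StarOrderedRing QLoc := CStarAlgebra.spectralOrderedRing QLoc

namespace QLoc

/-- The inclusion of `𝒜` in the bounded operators. -/
def toOp : QLoc →⋆ₐ[ℂ] (Fock →L[ℂ] Fock) := (opAlg Set.univ).subtype

theorem toOp_injective : Function.Injective toOp := Subtype.val_injective

/-- The algebra `𝒜_X` of quasi-local observables supported in `X`. -/
def observables (X : Set Edge) : StarSubalgebra ℂ QLoc := (opAlg X).comap toOp

theorem opX_mem (x : Edge) : opX x ∈ opAlg Set.univ :=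
  StarSubalgebra.le_topologicalClosure _
    (StarAlgebra.subset_adjoin ℂ _ (Or.inl ⟨x, trivial, rfl⟩))

theorem opZ_mem (x : Edge) : opZ x ∈ opAlg Set.univ :=
  StarSubalgebra.le_topologicalClosure _
    (StarAlgebra.subset_adjoin ℂ _ (Or.inr ⟨x, trivial, rfl⟩))

/-- `σ^X_x` as an element of `𝒜`. -/
def sigmaX (x : Edge) : QLoc := (⟨opX x, opX_mem x⟩ : opAlg Set.univ)

/-- `σ^Z_x` as an element of `𝒜`. -/
def sigmaZ (x : Edge) : QLoc := (⟨opZ x, opZ_mem x⟩ : opAlg Set.univ)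

@[simp] theorem toOp_sigmaX (x : Edge) : toOp (sigmaX x) = opX x := rfl

@[simp] theorem toOp_sigmaZ (x : Edge) : toOp (sigmaZ x) = opZ x := rfl

/-- The Pauli matrices in `𝒜`. -/
def gens : Set QLoc := Set.range sigmaX ∪ Set.range sigmaZ

theorem gens_dense : (StarAlgebra.adjoin ℂ gens).topologicalClosure = ⊤ := by
  rw [eq_top_iff]
  intro O _
  have hO : toOp O ∈ (StarAlgebra.adjoin ℂ (paulis Set.univ)).topologicalClosure := O.2
  have him : toOp '' gens = paulis Set.univ := by
    simp only [gens, paulis, Set.image_union, Set.image_univ, ← Set.range_comp]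
    rfl
  rw [← him, ← StarAlgHom.map_adjoin] at hO
  have hind : Topology.IsInducing (toOp : QLoc → (Fock →L[ℂ] Fock)) :=
    Topology.IsInducing.subtypeVal
  change O ∈ closure ((StarAlgebra.adjoin ℂ gens : StarSubalgebra ℂ QLoc) : Set QLoc)
  rw [hind.closure_eq_preimage_closure_image]
  exact hO

theorem ext_op {a b : QLoc} (h : ∀ (ψ : Fock) (s : Config), toOp a ψ s = toOp b ψ s) : a = b := by
  apply toOp_injective
  ext ψ s
  exact h ψ s

@[simp] theorem opX_apply (x : Edge) (ψ : Fock) (s : Config) : opX x ψ s = ψ (s ∆ {x}) := by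
  simp [opX, flipEdge]

@[simp] theorem opZ_apply (x : Edge) (ψ : Fock) (s : Config) :
    opZ x ψ s = (if x ∈ s then -1 else 1) * ψ s := by
  simp [opZ]

theorem sigmaX_mul_self (x : Edge) : sigmaX x * sigmaX x = 1 :=
  ext_op fun ψ s => by simp

theorem sigmaZ_mul_self (x : Edge) : sigmaZ x * sigmaZ x = 1 :=
  ext_op fun ψ s => by
    simp only [map_mul, toOp_sigmaZ, mul_apply_eq_comp, opZ_apply, map_one,
      one_apply_eq_self]
    split_ifs <;> simp

theorem sigmaX_comm (x y : Edge) : Commute (sigmaX x) (sigmaX y) :=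
  ext_op fun ψ s => by
    simp [symmDiff_assoc, symmDiff_comm ({x} : Config)]

theorem sigmaZ_comm (x y : Edge) : Commute (sigmaZ x) (sigmaZ y) :=
  ext_op fun ψ s => by
    simp only [map_mul, toOp_sigmaZ, mul_apply_eq_comp, opZ_apply]
    ring

theorem sigmaX_sigmaZ_comm {x y : Edge} (h : x ≠ y) : Commute (sigmaX x) (sigmaZ y) :=
  ext_op fun ψ s => by
    have h' : y ≠ x := h.symm
    simp [Finset.mem_symmDiff, h']

theorem star_sigmaX (x : Edge) : star (sigmaX x) = sigmaX x := by
  apply toOp_injective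
  rw [map_star, toOp_sigmaX, ContinuousLinearMap.star_eq_adjoint, eq_comm,
    ContinuousLinearMap.eq_adjoint_iff]
  intro ψ χ
  rw [lp.inner_eq_tsum, lp.inner_eq_tsum, ← (flipEdge x).tsum_eq]
  refine tsum_congr fun s => ?_
  simp [flipEdge]

theorem star_sigmaZ (x : Edge) : star (sigmaZ x) = sigmaZ x := by
  apply toOp_injective
  rw [map_star, toOp_sigmaZ, ContinuousLinearMap.star_eq_adjoint, eq_comm,
    ContinuousLinearMap.eq_adjoint_iff]
  intro ψ χ
  rw [lp.inner_eq_tsum, lp.inner_eq_tsum]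
  refine tsum_congr fun s => ?_
  simp only [opZ_apply]
  split_ifs <;> simp

/-- `σ^X_x` as a unitary. -/
def uX (x : Edge) : unitary QLoc :=
  ⟨sigmaX x, by
    rw [Unitary.mem_iff, star_sigmaX, sigmaX_mul_self]
    exact ⟨rfl, rfl⟩⟩

/-- `σ^Z_x` as a unitary. -/
def uZ (x : Edge) : unitary QLoc :=
  ⟨sigmaZ x, by
    rw [Unitary.mem_iff, star_sigmaZ, sigmaZ_mul_self]
    exact ⟨rfl, rfl⟩⟩

/-- The unitary `c ^ ((1 - σ^Z_x) / 2)` for a phase `c`: it is `1` where `σ^Z_x = 1` and `c` where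
`σ^Z_x = -1`. -/
def uPhase (c : unitary ℂ) (x : Edge) : unitary QLoc :=
  ⟨(1 / 2 : ℂ) • (1 + sigmaZ x) + ((c : ℂ) / 2) • (1 - sigmaZ x), by
    have h1 : star (c : ℂ) * c = 1 := Unitary.coe_star_mul_self c
    have h := sigmaZ_mul_self x
    have hp : (1 + sigmaZ x) * (1 + sigmaZ x) = (2 : ℂ) • (1 + sigmaZ x) := by
      simp only [mul_add, add_mul, h, mul_one, one_mul, two_smul]; abel
    have hm : (1 - sigmaZ x) * (1 - sigmaZ x) = (2 : ℂ) • (1 - sigmaZ x) := by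
      simp only [mul_sub, sub_mul, h, mul_one, one_mul, two_smul]; abel
    have hpm : (1 + sigmaZ x) * (1 - sigmaZ x) = 0 := by
      simp only [mul_sub, add_mul, h, mul_one, one_mul]; abel
    have hmp : (1 - sigmaZ x) * (1 + sigmaZ x) = 0 := by
      simp only [sub_mul, mul_add, h, mul_one, one_mul]; abel
    have hs : star ((1 / 2 : ℂ) • (1 + sigmaZ x) + ((c : ℂ) / 2) • (1 - sigmaZ x)) =
        (1 / 2 : ℂ) • (1 + sigmaZ x) + (star (c : ℂ) / 2) • (1 - sigmaZ x) := by
      simp [star_sigmaZ]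
    have hsum : (1 / 2 : ℂ) • (1 + sigmaZ x) + (1 / 2 : ℂ) • (1 - sigmaZ x) = 1 := by
      rw [← smul_add]
      simp only [add_add_sub_cancel, ← two_smul ℂ (1 : QLoc), smul_smul]
      norm_num
    rw [Unitary.mem_iff, hs]
    clear hs
    generalize 1 + sigmaZ x = p at *
    generalize 1 - sigmaZ x = m at *
    constructor <;>
    · simp only [mul_add, add_mul, smul_mul_smul_comm]
      rw [hp, hm, hpm, hmp, smul_smul, smul_smul, smul_zero, smul_zero, add_zero, zero_add]
      rw [← hsum]
      congr 2
      · norm_num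
      · linear_combination (1 / 2 : ℂ) * h1⟩

/-- The unitary `(-1) ^ s` for the projection `s = (1 - σ^Z_x) (1 + σ^Z_y) / 4`, that is,
`1 - 2 s`. -/
def uSign (x y : Edge) : unitary QLoc :=
  ⟨1 - (2 : ℂ) • ((1 / 4 : ℂ) • ((1 - sigmaZ x) * (1 + sigmaZ y))), by
    have hx := sigmaZ_mul_self x
    have hy := sigmaZ_mul_self y
    have hc := (sigmaZ_comm x y).eq
    have hm : (1 - sigmaZ x) * (1 - sigmaZ x) = (2 : ℂ) • (1 - sigmaZ x) := by
      simp only [mul_sub, sub_mul, hx, mul_one, one_mul, two_smul]; abel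
    have hp : (1 + sigmaZ y) * (1 + sigmaZ y) = (2 : ℂ) • (1 + sigmaZ y) := by
      simp only [mul_add, add_mul, hy, mul_one, one_mul, two_smul]; abel
    have hcc : (1 + sigmaZ y) * (1 - sigmaZ x) = (1 - sigmaZ x) * (1 + sigmaZ y) := by
      simp only [mul_add, add_mul, mul_sub, sub_mul, mul_one, one_mul, hc]; abel
    have hq : ((1 - sigmaZ x) * (1 + sigmaZ y)) * ((1 - sigmaZ x) * (1 + sigmaZ y)) =
        (4 : ℂ) • ((1 - sigmaZ x) * (1 + sigmaZ y)) := by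
      rw [mul_assoc, ← mul_assoc (1 + sigmaZ y), hcc, mul_assoc, hp, ← mul_assoc, hm,
        smul_mul_assoc, mul_smul_comm, smul_smul]
      norm_num
    have hs : star (1 - (2 : ℂ) • ((1 / 4 : ℂ) • ((1 - sigmaZ x) * (1 + sigmaZ y)))) =
        1 - (2 : ℂ) • ((1 / 4 : ℂ) • ((1 - sigmaZ x) * (1 + sigmaZ y))) := by
      simp [star_sigmaZ, hcc]
    rw [Unitary.mem_iff, hs, and_self]
    generalize (1 - sigmaZ x) * (1 + sigmaZ y) = q at *
    simp only [mul_sub, sub_mul, mul_one, one_mul, smul_mul_smul_comm, smul_smul, hq]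
    module⟩

theorem commute_uX (x y : Edge) : Commute (uX x) (uX y) :=
  Subtype.ext (sigmaX_comm x y).eq

/-- An element that commutes with `σ^Z_x` commutes with `c ^ ((1 - σ^Z_x) / 2)`. -/
theorem commute_uPhase {c : unitary ℂ} {x : Edge} {a : QLoc} (h : Commute (sigmaZ x) a) :
    Commute (uPhase c x : QLoc) a :=
  (((Commute.one_left a).add_left h).smul_left _).add_left
    (((Commute.one_left a).sub_left h).smul_left _)

theorem commute_uSign {x y : Edge} {a : QLoc} (hx : Commute (sigmaZ x) a)
    (hy : Commute (sigmaZ y) a) : Commute (uSign x y : QLoc) a :=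
  (Commute.one_left a).sub_left
    (((((Commute.one_left a).sub_left hx).mul_left
      ((Commute.one_left a).add_left hy)).smul_left _).smul_left _)

end QLoc

/-! ### String operators -/

open QLoc

theorem fiber_finite (f : Dart → Edge) (hf : ∀ i, Function.Injective fun p => f (p, i))
    (x : Edge) : {d | f d = x}.Finite := by
  refine Set.Finite.of_injOn (f := Prod.snd) (t := Set.univ) (fun _ _ => Set.mem_univ _) ?_
    Set.finite_univ
  rintro ⟨p, i⟩ hp ⟨q, j⟩ hq (rfl : i = j)
  exact Prod.ext (hf i (hp.trans hq.symm)) rfl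

namespace Dart

theorem edgeOf_injective (i : Fin 6) : Function.Injective fun p => edgeOf p i := by
  intro p q h
  fin_cases i <;> simpa [edgeOf] using h

/-- The leg on the right of the vertex between `d` and `d.turnLeft`: the edge common to the hexagons
`d.right` and `d.ahead`. -/
def rightLeg (d : Dart) : Edge := edgeOf d.right (d.2 + 2)

theorem edge_fiber (x : Edge) : {d : Dart | d.edge = x}.Finite :=
  fiber_finite _ edgeOf_injective x

theorem rightLeg_fiber (x : Edge) : {d : Dart | d.rightLeg = x}.Finite :=
  fiber_finite _ (fun i p q h =>
    add_right_cancel (edgeOf_injective (i + 2) h : p + dir i = q + dir i)) x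

theorem turnRight_fiber (x : Edge) : {d : Dart | d.turnRight.edge = x}.Finite :=
  fiber_finite _ (fun i p q h =>
    add_right_cancel (edgeOf_injective (i - 1) h : p + dir (i + 1) = q + dir (i + 1))) x

end Dart

/-! An oriented path is described by the set `P` of its oriented edges. At a vertex of the path
between two consecutive edges `d` and `d'` of `P`, either `d' = d.turnLeft` and the third edge at the
vertex is an R-leg, the edge `d.rightLeg`; or `d' = d.turnRight`, the third edge lies to the left of
the path, and the vertex is an L-vertex. -/

open Classical in
/-- The factors of `∏_{j ∈ P} σ^X_j`. -/
def xFactor (P : Set Dart) (d : Dart) : unitary QLoc :=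
  if d ∈ P then uX d.edge else 1

open Classical in
/-- The factors of `∏_{R-legs j} c ^ ((1 - σ^Z_j) / 2)`. -/
def legFactor (c : unitary ℂ) (P : Set Dart) (d : Dart) : unitary QLoc :=
  if d ∈ P ∧ d.turnLeft ∈ P then uPhase c d.rightLeg else 1

open Classical in
/-- The factors of `∏_{L-vertices v} (-1) ^ s_v`, where `s_v = (1 - σ^Z_j) (1 + σ^Z_k) / 4` for the
edges `j` and `k` of `P` that go in and out of `v`. -/
def vertexFactor (P : Set Dart) (d : Dart) : unitary QLoc :=
  if d ∈ P ∧ d.turnRight ∈ P then uSign d.edge d.turnRight.edge else 1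

open Classical in
/-- The factors of `∏_{R-legs j} σ^Z_j`. -/
def legZFactor (P : Set Dart) (d : Dart) : unitary QLoc :=
  if d ∈ P ∧ d.turnLeft ∈ P then uZ d.rightLeg else 1

theorem xFactor_comm (P : Set Dart) (d d' : Dart) : Commute (xFactor P d) (xFactor P d') := by
  unfold xFactor
  split_ifs <;> first | exact commute_uX _ _ | exact Commute.one_left _ | exact Commute.one_right _

theorem legFactor_comm (c : unitary ℂ) (P : Set Dart) (d d' : Dart) :
    Commute (legFactor c P d) (legFactor c P d') := by
  unfold legFactor
  split_ifs <;> first | exact Commute.one_left _ | exact Commute.one_right _ | skip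
  exact Subtype.ext (commute_uPhase (commute_uPhase (sigmaZ_comm _ _)).symm).eq

theorem vertexFactor_comm (P : Set Dart) (d d' : Dart) :
    Commute (vertexFactor P d) (vertexFactor P d') := by
  unfold vertexFactor
  split_ifs <;> first | exact Commute.one_left _ | exact Commute.one_right _ | skip
  exact Subtype.ext (commute_uSign (commute_uSign (sigmaZ_comm _ _) (sigmaZ_comm _ _)).symm
    (commute_uSign (sigmaZ_comm _ _) (sigmaZ_comm _ _)).symm).eq

theorem legZFactor_comm (P : Set Dart) (d d' : Dart) :
    Commute (legZFactor P d) (legZFactor P d') := by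
  unfold legZFactor
  split_ifs <;> first | exact Commute.one_left _ | exact Commute.one_right _ | skip
  exact Subtype.ext (sigmaZ_comm _ _).eq

theorem xFactor_local (P : Set Dart) :
    ∀ g ∈ gens, {d | ¬ Commute (xFactor P d : QLoc) g}.Finite := by
  rintro _ (⟨x, rfl⟩ | ⟨x, rfl⟩) <;> refine (Dart.edge_fiber x).subset fun d hd => ?_ <;>
    by_contra h <;> refine hd ?_ <;> unfold xFactor <;> split_ifs
  · exact sigmaX_comm _ _
  · exact Commute.one_left _
  · exact sigmaX_sigmaZ_comm h
  · exact Commute.one_left _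

theorem legFactor_local (c : unitary ℂ) (P : Set Dart) :
    ∀ g ∈ gens, {d | ¬ Commute (legFactor c P d : QLoc) g}.Finite := by
  rintro _ (⟨x, rfl⟩ | ⟨x, rfl⟩) <;> refine (Dart.rightLeg_fiber x).subset fun d hd => ?_ <;>
    by_contra h <;> refine hd ?_ <;> unfold legFactor <;> split_ifs
  · exact commute_uPhase (sigmaX_sigmaZ_comm (Ne.symm h)).symm
  · exact Commute.one_left _
  · exact commute_uPhase (sigmaZ_comm _ _)
  · exact Commute.one_left _

theorem legZFactor_local (P : Set Dart) :
    ∀ g ∈ gens, {d | ¬ Commute (legZFactor P d : QLoc) g}.Finite := by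
  rintro _ (⟨x, rfl⟩ | ⟨x, rfl⟩) <;> refine (Dart.rightLeg_fiber x).subset fun d hd => ?_ <;>
    by_contra h <;> refine hd ?_ <;> unfold legZFactor <;> split_ifs
  · exact (sigmaX_sigmaZ_comm (Ne.symm h)).symm
  · exact Commute.one_left _
  · exact sigmaZ_comm _ _
  · exact Commute.one_left _

theorem vertexFactor_local (P : Set Dart) :
    ∀ g ∈ gens, {d | ¬ Commute (vertexFactor P d : QLoc) g}.Finite := by
  rintro _ (⟨x, rfl⟩ | ⟨x, rfl⟩) <;>
    refine ((Dart.edge_fiber x).union (Dart.turnRight_fiber x)).subset fun d hd => ?_ <;>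
    by_contra h <;> rw [Set.mem_union, not_or] at h <;> refine hd ?_ <;> unfold vertexFactor <;>
    split_ifs
  · exact commute_uSign (sigmaX_sigmaZ_comm (Ne.symm h.1)).symm
      (sigmaX_sigmaZ_comm (Ne.symm h.2)).symm
  · exact Commute.one_left _
  · exact commute_uSign (sigmaZ_comm _ _) (sigmaZ_comm _ _)
  · exact Commute.one_left _

/-- Conjugation with the (possibly formal) product `∏_{j ∈ P} σ^X_j`. -/
def adX (P : Set Dart) : QLoc ≃⋆ₐ[ℂ] QLoc :=
  formalAd (xFactor P) (xFactor_comm P) gens gens_dense (xFactor_local P)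

/-- Conjugation with the (possibly formal) product `∏_{R-legs j} c ^ ((1 - σ^Z_j) / 2)`. -/
def adLegs (c : unitary ℂ) (P : Set Dart) : QLoc ≃⋆ₐ[ℂ] QLoc :=
  formalAd (legFactor c P) (legFactor_comm c P) gens gens_dense (legFactor_local c P)

/-- Conjugation with the (possibly formal) product `∏_{L-vertices v} (-1) ^ s_v`. -/
def adVertices (P : Set Dart) : QLoc ≃⋆ₐ[ℂ] QLoc :=
  formalAd (vertexFactor P) (vertexFactor_comm P) gens gens_dense (vertexFactor_local P)

/-- Conjugation with the (possibly formal) product `∏_{R-legs j} σ^Z_j`. -/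
def adLegsZ (P : Set Dart) : QLoc ≃⋆ₐ[ℂ] QLoc :=
  formalAd (legZFactor P) (legZFactor_comm P) gens gens_dense (legZFactor_local P)

/-- The imaginary unit as a phase. -/
def phaseI : unitary ℂ := ⟨Complex.I, by simp [Unitary.mem_iff]⟩

/-- Minus the imaginary unit as a phase. -/
def phaseNegI : unitary ℂ := ⟨-Complex.I, by simp [Unitary.mem_iff]⟩

/-- The set `I = {1, S, S̄, B}` of anyon types: vacuum, semion, anti-semion and bound state. -/
inductive Anyon : Type
  | vac
  | semion
  | antisemion
  | bound

namespace Anyon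

/-- The fusion product of anyon types. -/
def fuse : Anyon → Anyon → Anyon
  | vac, b => b
  | a, vac => a
  | semion, semion => vac
  | semion, antisemion => bound
  | semion, bound => antisemion
  | antisemion, semion => bound
  | antisemion, antisemion => vac
  | antisemion, bound => semion
  | bound, semion => antisemion
  | bound, antisemion => semion
  | bound, bound => vac

instance : CommGroup Anyon where
  mul := fuse
  one := vac
  inv a := a
  mul_assoc a b c := by cases a <;> cases b <;> cases c <;> rfl
  one_mul a := by cases a <;> rfl
  mul_one a := by cases a <;> rfl
  inv_mul_cancel a := by cases a <;> rfl
  mul_comm a b := by cases a <;> cases b <;> rfl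

end Anyon

/-- The string automorphism `w_a[P]`: conjugation with the (possibly formal) unitary
`W_S[P] = (∏_{j ∈ P} σ^X_j) (∏_{R-legs j} i ^ ((1 - σ^Z_j) / 2)) (∏_{L-vertices v} (-1) ^ s_v)`,
with `-i` in place of `i` for `S̄`, and `W_B[P] = ∏_{R-legs j} σ^Z_j`, `W_1[P] = 1`. -/
def stringAut : Anyon → Set Dart → (QLoc ≃⋆ₐ[ℂ] QLoc)
  | .vac, _ => StarAlgEquiv.refl ℂ QLoc
  | .semion, P => ((adVertices P).trans (adLegs phaseI P)).trans (adX P)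
  | .antisemion, P => ((adVertices P).trans (adLegs phaseNegI P)).trans (adX P)
  | .bound, P => adLegsZ P

/-- The automorphism `w` is supported in `X`: it is the identity on `𝒜_{Xᶜ}`. -/
def SupportedIn (w : QLoc ≃⋆ₐ[ℂ] QLoc) (X : Set Edge) : Prop :=
  ∀ O ∈ observables Xᶜ, w O = O

/-- The path `P_Λ`, truncated at distance `n` from the apex: the part of the boundary of the set of
hexagons overlapping with the right half of the cone that follows the left leg of this half-cone,
which is the axis of the cone. -/
def Cone.path (c : Cone) (n : ℝ) : Set Dart := c.rightHalf.leftPath n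

/-- The automorphism `w_{a, Λ}`, for the truncation distance `n`. -/
def coneAut (c : Cone) (n : ℝ) (a : Anyon) : QLoc ≃⋆ₐ[ℂ] QLoc := stringAut a (c.path n)

/-- The truncation distance `n` is admissible for a cone if `n > 2` and all `w_{a, Λ}` are supported
in the cone. -/
def Cone.Admissible (c : Cone) (n : ℝ) : Prop :=
  2 < n ∧ ∀ a, SupportedIn (coneAut c n a) c.sites

/-! ### The double semion state -/

/-- The vector `Ω₀` without any strings. -/
def vacuum : Fock := lp.single 2 (∅ : Config) (1 : ℂ)

/-- `A_Q = ∏_{x ∈ ∂Q} σ^X_x`, which creates a string around the finite set of hexagons `Q`. -/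
def loopOp (Q : Finset Hex) : QLoc := (partialProd uX commute_uX (boundaryEdges Q) : unitary QLoc)

/-- The superposition of the closed string configurations `∂R` with `R ⊆ Q`, with signs given by the
parity of the number of connected components of the string configuration. -/
def loopVector (Q : Finset Hex) : Fock :=
  ((√(1 / 2 ^ Q.card) : ℝ) : ℂ) •
    ∑ R ∈ Q.powerset, (-1 : ℂ) ^ numStrings R • toOp (loopOp R) vacuum

/-- The state on `𝒜` given by the vector `loopVector Q`. -/
def loopState (Q : Finset Hex) (O : QLoc) : ℂ :=
  inner ℂ (loopVector Q) (toOp O (loopVector Q))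

open scoped ComplexOrder in
/-- Positive linear functionals on `𝒜`. -/
abbrev PosFunctional : Type := QLoc →ₚ[ℂ] ℂ

/-- `ω` is a weak-* limit point of the states `loopState (Q n)` for some increasing sequence `Q` of
finite sets of hexagons that exhausts the lattice. In particular the limit of a weak-* convergent
sequence of this form, the double semion state, has this property. -/
def IsDoubleSemionState (ω : PosFunctional) : Prop :=
  ∃ Q : ℕ → Finset Hex, Monotone Q ∧ (∀ p, ∃ n, p ∈ Q n) ∧
    MapClusterPt (fun O => ω O) atTop (fun n O => loopState (Q n) O)

/-- The von Neumann algebra `ℛ(X) = π(𝒜_X)''` in the GNS representation `π` of `ω`. -/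
def vonNeumann (ω : PosFunctional) (X : Set Edge) : Set (ω.GNS →L[ℂ] ω.GNS) :=
  Set.centralizer (Set.centralizer (ω.gnsStarAlgHom '' (observables X : Set QLoc)))

end DoubleSemion
end

noncomputable section

open Filter Topology
open scoped symmDiff

namespace DoubleSemion

open QLoc

/-! ### Calculus of formal products -/

section FormalProducts

variable {A : Type*} [CStarAlgebra A] {ι : Type*}

/-! Write `W_S = X L V` with `X` the product of the `σ^X` along the path, `L` the phases at the
R-legs and `V` the signs at the L-vertices. Flipping the edges of the path leaves `L` alone and
exchanges the roles of the ingoing edge `j` and the outgoing edge `k` in `(-1) ^ s_v`, so that `X V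
X V` is the product of `σ^Z_j σ^Z_k` over the L-vertices. Hence a composition of two semion-type
strings is conjugation with a diagonal formal product: L-vertices contribute `σ^Z_j σ^Z_k`, R-legs
the product of the two phases (`isFormalAd_semionAut_semionAut`).

Consider the square of the S-string, where the R-legs contribute `i ^ 2`, that is `σ^Z`. Multiply it
by `σ^Z_d σ^Z_{d'}` for all consecutive edges `d`, `d'` of the path. Every interior edge occurs
twice, so this changes the product only at the ends of the path. Now L-vertices contribute nothing,
and a vertex with an R-leg contributes the product of the three `σ^Z` around it
(`squareFactor_mul_telescope`). These star operators fix the GNS vector, since every vertex meets an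
even number of edges of a closed string configuration (`starFactor_loopOp`,
`IsDoubleSemionState.starFactor`). Only closedness of the strings matters here; the signs `(-1) ^
♯Π` play no role.

A formal product of commuting involutions that fix the cyclic vector converges strongly in the GNS
representation: on vectors `π(O)Ω` its partial products act as `π(Ad(·)O)Ω`, which converges in
norm. The strong limit is a unitary in the bicommutant (`IsFormalAd.exists_implementer`). Together
with the local unitary from the ends it implements the square.

All fusion rules follow from this one unitary. `S × S`, `S̄ × S̄`, `S × S̄` and `S̄ × S` hold after
composing with the square; the others are exact identities of automorphisms.

Two points remain. Far from the apex the path runs within bounded distance of the axis of the cone,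
hence in its interior, and it has finitely many ends (`Cone.mem_region_of_dist_le`,
`Cone.finite_ends`). Conversely, for an admissible truncation the support of `w_S` detects every
edge and every R-leg of the path, so that the implementer lies in `ℛ(Λ)` (`edge_mem_of_supportedIn`,
`rightLeg_mem_of_supportedIn`). -/

/-- `φ` is conjugation with the formal product `∏ i, u i`. -/
def IsFormalAd (u : ι → unitary A) (hu : ∀ i j, Commute (u i) (u j)) (φ : A → A) : Prop :=
  ∀ x, Tendsto (fun T => conj (partialProd u hu T) x) atTop (𝓝 (φ x))

/-- Identities between automorphisms reduce to identities between the individual factors. -/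
theorem IsFormalAd.unique {u v : ι → unitary A} {hu : ∀ i j, Commute (u i) (u j)}
    {hv : ∀ i j, Commute (v i) (v j)} {φ ψ : A → A} (h : IsFormalAd u hu φ)
    (h' : IsFormalAd v hv ψ) (huv : u = v) : φ = ψ := by
  subst huv
  exact funext fun x => tendsto_nhds_unique (h x) (h' x)

theorem partialProd_mul (u v : ι → unitary A) (hu : ∀ i j, Commute (u i) (u j))
    (hv : ∀ i j, Commute (v i) (v j)) (huv : ∀ i j, Commute (u i) (v j))
    (hw : ∀ i j, Commute ((u * v) i) ((u * v) j)) (T : Finset ι) :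
    partialProd (u * v) hw T = partialProd u hu T * partialProd v hv T :=
  Finset.noncommProd_mul_distrib u v (fun i _ j _ _ => hu i j) (fun i _ j _ _ => hv i j)
    (fun i _ j _ _ => (huv j i).symm)

theorem commute_mul_family {u v : ι → unitary A} (hu : ∀ i j, Commute (u i) (u j))
    (hv : ∀ i j, Commute (v i) (v j)) (huv : ∀ i j, Commute (u i) (v j)) (i j : ι) :
    Commute ((u * v) i) ((u * v) j) :=
  Commute.mul_left ((hu i j).mul_right (huv i j)) (((huv j i).symm).mul_right (hv i j))

/-- Conjugations are isometries, so the convergence is insensitive to a perturbation of the argument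
that tends to zero. -/
theorem conj_tendsto {U : Finset ι → unitary A} {x z : A} {y : Finset ι → A}
    (hy : Tendsto y atTop (𝓝 x)) (hU : Tendsto (fun T => conj (U T) x) atTop (𝓝 z)) :
    Tendsto (fun T => conj (U T) (y T)) atTop (𝓝 z) := by
  have h : Tendsto (fun T => conj (U T) (y T) - conj (U T) x) atTop (𝓝 0) := by
    rw [tendsto_zero_iff_norm_tendsto_zero]
    simp only [conj_isometry]
    exact tendsto_iff_norm_sub_tendsto_zero.1 hy
  simpa using h.add hU

/-- The same finite set `T` can be used in both limits by `conj_tendsto`. Commutation of the two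
families is needed to merge the two partial products into one. -/
theorem IsFormalAd.mul {u v : ι → unitary A} {hu : ∀ i j, Commute (u i) (u j)}
    {hv : ∀ i j, Commute (v i) (v j)} {φ ψ : A → A} (h : IsFormalAd u hu φ)
    (h' : IsFormalAd v hv ψ) (huv : ∀ i j, Commute (u i) (v j)) :
    IsFormalAd (u * v) (commute_mul_family hu hv huv) (φ ∘ ψ) := by
  intro x
  refine (conj_tendsto (h' x) (h (ψ x))).congr fun T => ?_
  rw [← conj_mul, partialProd_mul u v hu hv huv]

theorem isFormalAd_one : IsFormalAd (1 : ι → unitary A) (fun _ _ => Commute.one_left _) id := by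
  intro x
  refine tendsto_const_nhds.congr fun T => ?_
  have : partialProd (1 : ι → unitary A) (fun _ _ => Commute.one_left _) T = 1 :=
    Finset.noncommProd_induction T _ _ (· = 1) (by rintro a b rfl rfl; simp) rfl (fun _ _ => rfl)
  simp [this, conj]

/-- The product of a family of commuting involutions is an involution. -/
theorem IsFormalAd.involutive {u : ι → unitary A} {hu : ∀ i j, Commute (u i) (u j)}
    {φ : A → A} (h : IsFormalAd u hu φ) (hsq : ∀ i, u i * u i = 1) (x : A) : φ (φ x) = x :=
  congrFun ((h.mul h hu).unique isFormalAd_one (funext hsq)) x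

/-- A ⋆-automorphism turns formal products into formal products. -/
theorem IsFormalAd.map {u v : ι → unitary A} {hu : ∀ i j, Commute (u i) (u j)}
    {hv : ∀ i j, Commute (v i) (v j)} {φ : A → A} (h : IsFormalAd u hu φ) (α : A ≃⋆ₐ[ℂ] A)
    (huv : ∀ i, (v i : A) = α (u i)) : IsFormalAd v hv (fun x => α (φ (α.symm x))) := by
  classical
  intro x
  have hα : Continuous α := (StarAlgEquiv.isometry α).continuous
  refine ((hα.tendsto _).comp (h (α.symm x))).congr fun T => ?_
  have hp : (partialProd v hv T : A) = α (partialProd u hu T) := by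
    induction T using Finset.induction_on with
    | empty => simp [partialProd_empty]
    | insert a s ha ih => simp [partialProd_insert _ _ _ _ ha, ih, huv]
  simp [conj, hp, map_star]

/-- Reindexing does not change a formal product. -/
theorem IsFormalAd.reindex {u : ι → unitary A} {hu : ∀ i j, Commute (u i) (u j)}
    {φ : A → A} (h : IsFormalAd u hu φ) (σ : Equiv.Perm ι) :
    IsFormalAd (u ∘ σ) (fun i j => hu (σ i) (σ j)) φ := by
  classical
  intro x
  -- The images of finite sets under a permutation are again cofinal among the finite sets.
  have hσ : Tendsto (fun T : Finset ι => T.map σ.toEmbedding) atTop atTop := by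
    refine tendsto_atTop.2 fun S => ?_
    filter_upwards [eventually_ge_atTop (S.map σ.symm.toEmbedding)] with T hT
    intro a ha
    have : σ.symm a ∈ T := hT (by simpa using ha)
    exact Finset.mem_map.2 ⟨_, this, by simp⟩
  refine ((h x).comp hσ).congr fun T => ?_
  have hp : partialProd u hu (T.map σ.toEmbedding) =
      partialProd (u ∘ σ) (fun i j => hu (σ i) (σ j)) T := by
    induction T using Finset.induction_on with
    | empty => simp [partialProd_empty]
    | insert a s ha ih =>
      rw [Finset.map_insert, partialProd_insert _ _ _ _ (by simpa using ha),
        partialProd_insert _ _ _ _ ha, ih]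
      rfl
  simp [hp]

theorem commute_partialProd {u : ι → unitary A} (hu : ∀ i j, Commute (u i) (u j)) (T : Finset ι)
    {x : A} (h : ∀ i ∈ T, Commute (u i : A) x) : Commute (partialProd u hu T : A) x :=
  Finset.noncommProd_induction T u (fun i _ j _ _ => hu i j)
    (fun V : unitary A => Commute (V : A) x) (fun _ _ => Commute.mul_left) (Commute.one_left x) h

theorem partialProd_mem {u : ι → unitary A} (hu : ∀ i j, Commute (u i) (u j)) (T : Finset ι)
    {S : StarSubalgebra ℂ A} (h : ∀ i ∈ T, (u i : A) ∈ S) : (partialProd u hu T : A) ∈ S :=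
  Finset.noncommProd_induction T u (fun i _ j _ _ => hu i j)
    (fun V : unitary A => (V : A) ∈ S) (fun _ _ => mul_mem) (one_mem S) h

/-- Only the factors that do not commute with an element act on it. -/
theorem IsFormalAd.eq_conj {u : ι → unitary A} {hu : ∀ i j, Commute (u i) (u j)}
    {φ : A → A} (h : IsFormalAd u hu φ) {x : A} (S : Finset ι)
    (hS : ∀ i ∉ S, Commute (u i : A) x) : φ x = conj (partialProd u hu S) x := by
  classical
  refine tendsto_nhds_unique (h x) (tendsto_const_nhds.congr' ?_)
  filter_upwards [eventually_ge_atTop S] with T hT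
  have hs : partialProd u hu T = partialProd u hu S * partialProd u hu (T \ S) := by
    unfold partialProd
    rw [← Finset.noncommProd_union_of_disjoint Finset.disjoint_sdiff u (fun i _ j _ _ => hu i j)]
    exact Finset.noncommProd_congr (Finset.union_sdiff_of_subset hT).symm (fun _ _ => rfl) _
  rw [hs, conj_mul, conj_of_commute (partialProd u hu (T \ S)) x]
  exact commute_partialProd hu _ fun i hi => hS i (Finset.mem_sdiff.1 hi).2

theorem IsFormalAd.fixes {u : ι → unitary A} {hu : ∀ i j, Commute (u i) (u j)}
    {φ : A → A} (h : IsFormalAd u hu φ) {x : A} (hx : ∀ i, Commute (u i : A) x) : φ x = x := by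
  rw [h.eq_conj ∅ fun i _ => hx i]
  simp [partialProd_empty, conj]

theorem formalAd_isFormalAd (u : ι → unitary A) (hu : ∀ i j, Commute (u i) (u j))
    (G : Set A) (hG : (StarAlgebra.adjoin ℂ G).topologicalClosure = ⊤)
    (hloc : ∀ g ∈ G, {i | ¬ Commute (u i : A) g}.Finite) :
    IsFormalAd u hu (formalAd u hu G hG hloc) :=
  formalAd_tendsto u hu G hG hloc

/-- A ⋆-automorphism that fixes the generators of a closed subalgebra fixes the subalgebra. -/
theorem fixes_of_generators (φ : A ≃⋆ₐ[ℂ] A) (G : Set A) (h : ∀ g ∈ G, φ g = g) {x : A}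
    (hx : x ∈ (StarAlgebra.adjoin ℂ G).topologicalClosure) : φ x = x := by
  have hφ : Continuous φ := (StarAlgEquiv.isometry φ).continuous
  have hle : StarAlgebra.adjoin ℂ G ≤ StarAlgHom.equalizer (φ : A →⋆ₐ[ℂ] A) (StarAlgHom.id ℂ A) :=
    StarAlgebra.adjoin_le h
  exact StarSubalgebra.topologicalClosure_minimal hle
    (isClosed_eq hφ continuous_id) hx

end FormalProducts

/-! ### Combinatorics of oriented edges -/

theorem dir_add_three (i : Fin 6) : dir i + dir (i + 3) = 0 := by
  fin_cases i <;> rfl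

theorem dir_add_dir_add_two (i : Fin 6) : dir i + dir (i + 2) = dir (i + 1) := by
  fin_cases i <;> rfl

namespace Dart

/-- The same edge with the opposite orientation. -/
def rev (d : Dart) : Dart := (d.right, d.2 + 3)

theorem rev_left (d : Dart) : d.rev.left = d.right := rfl

theorem rev_right (d : Dart) : d.rev.right = d.left := by
  change d.1 + dir d.2 + dir (d.2 + 3) = d.1
  rw [add_assoc, dir_add_three, add_zero]

theorem rev_rev (d : Dart) : d.rev.rev = d := by
  refine Prod.ext d.rev_right ?_
  change d.2 + 3 + 3 = d.2
  rw [add_assoc]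
  exact add_zero d.2

theorem rev_edge (d : Dart) : d.rev.edge = d.edge := by
  obtain ⟨p, i⟩ := d
  have h3 : ∀ j k : Fin 6, dir j + dir k = 0 → p + dir j + dir k = p := fun j k h => by
    rw [add_assoc, h, add_zero]
  fin_cases i
  · exact Prod.ext (h3 0 3 rfl) rfl
  · exact Prod.ext (h3 1 4 rfl) rfl
  · exact Prod.ext (h3 2 5 rfl) rfl
  · rfl
  · rfl
  · rfl

/-- The orientation of an edge used to label it. -/
def ofEdge (e : Edge) : Dart := (e.1, Fin.castLE (by norm_num) e.2)

theorem eq_ofEdge_or (d : Dart) : d = ofEdge d.edge ∨ d = (ofEdge d.edge).rev := by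
  obtain ⟨p, i⟩ := d
  have h3 : ∀ j k : Fin 6, dir j + dir k = 0 → p = p + dir j + dir k := fun j k h => by
    rw [add_assoc, h, add_zero]
  fin_cases i
  · exact Or.inl rfl
  · exact Or.inl rfl
  · exact Or.inl rfl
  · exact Or.inr (Prod.ext (h3 3 0 rfl) rfl)
  · exact Or.inr (Prod.ext (h3 4 1 rfl) rfl)
  · exact Or.inr (Prod.ext (h3 5 2 rfl) rfl)

theorem eq_or_eq_rev {d d' : Dart} (h : d.edge = d'.edge) : d = d' ∨ d = d'.rev := by
  have h1 := eq_ofEdge_or d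
  have h2 := eq_ofEdge_or d'
  rw [h] at h1
  generalize ofEdge d'.edge = a at h1 h2
  rcases h1 with rfl | rfl <;> rcases h2 with rfl | rfl
  · exact Or.inl rfl
  · exact Or.inr (rev_rev d).symm
  · exact Or.inr rfl
  · exact Or.inl rfl

/-- The R-leg at the final vertex, oriented towards that vertex. -/
def legDart (d : Dart) : Dart := (d.right, d.2 + 2)

theorem legDart_edge (d : Dart) : d.legDart.edge = d.rightLeg := rfl

theorem legDart_left (d : Dart) : d.legDart.left = d.right := rfl

theorem legDart_right (d : Dart) : d.legDart.right = d.ahead := by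
  change d.1 + dir d.2 + dir (d.2 + 2) = d.1 + dir (d.2 + 1)
  rw [add_assoc, dir_add_dir_add_two]

theorem legDart_injective : Function.Injective legDart := by
  rintro ⟨p, i⟩ ⟨q, j⟩ h
  have h2 : i = j := add_right_cancel (congrArg Prod.snd h)
  subst h2
  exact Prod.ext (add_right_cancel (congrArg Prod.fst h : p + dir i = q + dir i)) rfl

/-- The hexagon behind an oriented edge. -/
def behind (d : Dart) : Hex := d.1 + dir (d.2 - 1)

end Dart

/-! ### Oriented boundaries of sets of hexagons -/

section Boundary

variable {Q : Set Hex}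

/-- The boundary contains at most one orientation of an edge: the reversed one has its left hexagon
outside of `Q`. -/
theorem boundary_edge_inj {d d' : Dart} (hd : d ∈ boundary Q) (hd' : d' ∈ boundary Q)
    (h : d.edge = d'.edge) : d = d' := by
  rcases Dart.eq_or_eq_rev h with h | h
  · exact h
  · refine absurd hd.1 ?_
    rw [h, Dart.rev_left]
    exact hd'.2

/-- At a left turn the R-leg separates the hexagons `d.right` and `d.ahead`, which both lie outside
of `Q`, whereas a boundary edge has a hexagon of `Q` on its left. -/
theorem rightLeg_ne_of_boundary {d d' : Dart} (hd : d ∈ boundary Q)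
    (hl : d.turnLeft ∈ boundary Q) (hd' : d' ∈ boundary Q) : d'.edge ≠ d.rightLeg := by
  intro h
  rw [← Dart.legDart_edge] at h
  have h1 := hd'.1
  rcases Dart.eq_or_eq_rev h with h | h <;> rw [h] at h1
  · exact hd.2 h1
  · rw [Dart.rev_left, Dart.legDart_right] at h1
    exact hl.2 h1

theorem turnRight_notMem_of_turnLeft_mem {d : Dart} (hl : d.turnLeft ∈ boundary Q) :
    d.turnRight ∉ boundary Q := fun h => hl.2 h.1

variable (Q)

open Classical in
/-- The successor of an oriented boundary edge along the boundary. -/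
def nextFun (d : Dart) : Dart :=
  if d ∈ boundary Q then (if d.ahead ∈ Q then d.turnRight else d.turnLeft) else d

open Classical in
/-- The predecessor of an oriented boundary edge along the boundary. -/
def prevFun (d : Dart) : Dart :=
  if d ∈ boundary Q then (if d.behind ∈ Q then (d.behind, d.2 + 1) else (d.1, d.2 - 1)) else d

/-- Traversing the boundary of a set of hexagons. -/
def next : Equiv.Perm Dart where
  toFun := nextFun Q
  invFun := prevFun Q
  left_inv d := by
    by_cases hd : d ∈ boundary Q
    -- After a right turn the hexagon behind the new edge is the old left hexagon, which is in `Q`;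
    -- after a left turn it is the old right hexagon, which is not. So membership of `behind`
    -- recovers the turn.
    · by_cases ha : d.ahead ∈ Q
      · have h1 : nextFun Q d = d.turnRight := by simp [nextFun, hd, ha]
        have hb : d.turnRight ∈ boundary Q := ⟨ha, by rw [Dart.turnRight_right]; exact hd.2⟩
        have hbe : d.turnRight.behind = d.1 := by
          obtain ⟨p, i⟩ := d
          change p + dir (i + 1) + dir (i - 1 - 1) = p
          rw [add_assoc, show i - 1 - 1 = i + 1 + 3 by fin_cases i <;> rfl, dir_add_three, add_zero]
        have hbm : d.turnRight.behind ∈ Q := by rw [hbe]; exact hd.1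
        rw [h1, prevFun, if_pos hb, if_pos hbm, hbe]
        exact Prod.ext rfl (sub_add_cancel d.2 1)
      · have h1 : nextFun Q d = d.turnLeft := by simp [nextFun, hd, ha]
        have hb : d.turnLeft ∈ boundary Q := ⟨hd.1, ha⟩
        have hbe : d.turnLeft.behind = d.right := by
          change d.1 + dir (d.2 + 1 - 1) = d.1 + dir d.2
          rw [add_sub_cancel_right]
        have hbm : d.turnLeft.behind ∉ Q := by rw [hbe]; exact hd.2
        rw [h1, prevFun, if_pos hb, if_neg hbm]
        exact Prod.ext rfl (add_sub_cancel_right d.2 1)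
    · rw [nextFun, if_neg hd, prevFun, if_neg hd]
  right_inv d := by
    by_cases hd : d ∈ boundary Q
    · by_cases ha : d.behind ∈ Q
      · have h1 : prevFun Q d = (d.behind, d.2 + 1) := by simp [prevFun, hd, ha]
        have hah : Dart.ahead (d.behind, d.2 + 1) = d.1 := by
          obtain ⟨p, i⟩ := d
          change p + dir (i - 1) + dir (i + 1 + 1) = p
          rw [add_assoc, show i + 1 + 1 = i - 1 + 3 by fin_cases i <;> rfl, dir_add_three, add_zero]
        have hr : Dart.right (d.behind, d.2 + 1) = d.right := by
          obtain ⟨p, i⟩ := d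
          change p + dir (i - 1) + dir (i + 1) = p + dir i
          rw [add_assoc, show i + 1 = i - 1 + 2 by fin_cases i <;> rfl, dir_add_dir_add_two,
            sub_add_cancel]
        have hb : (d.behind, d.2 + 1) ∈ boundary Q := ⟨ha, by rw [hr]; exact hd.2⟩
        have ham : Dart.ahead (d.behind, d.2 + 1) ∈ Q := by rw [hah]; exact hd.1
        rw [h1, nextFun, if_pos hb, if_pos ham]
        exact Prod.ext hah (add_sub_cancel_right d.2 1)
      · have h1 : prevFun Q d = (d.1, d.2 - 1) := by simp [prevFun, hd, ha]
        have hah : Dart.ahead (d.1, d.2 - 1) = d.right := by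
          change d.1 + dir (d.2 - 1 + 1) = d.1 + dir d.2
          rw [sub_add_cancel]
        have hb : (d.1, d.2 - 1) ∈ boundary Q := ⟨hd.1, ha⟩
        have ham : Dart.ahead (d.1, d.2 - 1) ∉ Q := by rw [hah]; exact hd.2
        rw [h1, nextFun, if_pos hb, if_neg ham]
        exact Prod.ext rfl (sub_add_cancel d.2 1)
    · rw [prevFun, if_neg hd, nextFun, if_neg hd]

variable {Q}

theorem next_mem_boundary {d : Dart} (hd : d ∈ boundary Q) : next Q d ∈ boundary Q := by
  change nextFun Q d ∈ _
  rw [nextFun, if_pos hd]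
  split_ifs with h
  · exact ⟨h, by rw [Dart.turnRight_right]; exact hd.2⟩
  · exact ⟨hd.1, h⟩

theorem next_eq_or {d : Dart} (hd : d ∈ boundary Q) :
    next Q d = d.turnLeft ∨ next Q d = d.turnRight := by
  change nextFun Q d = _ ∨ nextFun Q d = _
  rw [nextFun, if_pos hd]
  split_ifs with h
  · exact Or.inr rfl
  · exact Or.inl rfl

theorem next_of_notMem {d : Dart} (hd : d ∉ boundary Q) : next Q d = d := by
  change nextFun Q d = _
  rw [nextFun, if_neg hd]

theorem next_eq_turnLeft {d : Dart} (hd : d ∈ boundary Q) (hl : d.turnLeft ∈ boundary Q) :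
    next Q d = d.turnLeft := by
  change nextFun Q d = _
  rw [nextFun, if_pos hd]
  exact if_neg hl.2

theorem next_eq_turnRight {d : Dart} (hd : d ∈ boundary Q) (hl : d.turnRight ∈ boundary Q) :
    next Q d = d.turnRight := by
  change nextFun Q d = _
  rw [nextFun, if_pos hd]
  exact if_pos hl.1

end Boundary

/-! ### Implementation of formal products in GNS representations -/

section StrongLimits

variable {H : Type*} [NormedAddCommGroup H] [InnerProductSpace ℂ H] [CompleteSpace H]
  {κ : Type*} {l : Filter κ} [l.NeBot]

/-- A net of unitaries that converges on a dense set converges pointwise. -/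
theorem unitary_tendsto_of_dense (V : κ → unitary (H →L[ℂ] H)) (s : Set H) (hs : Dense s)
    (h : ∀ ξ ∈ s, ∃ η, Tendsto (fun k => (V k : H →L[ℂ] H) ξ) l (𝓝 η)) (ξ : H) :
    ∃ η, Tendsto (fun k => (V k : H →L[ℂ] H) ξ) l (𝓝 η) := by
  have hV : ∀ k (a b : H), dist ((V k : H →L[ℂ] H) a) ((V k : H →L[ℂ] H) b) = dist a b := by
    intro k a b
    rw [dist_eq_norm, dist_eq_norm, ← map_sub]
    exact Unitary.norm_map (V k) (a - b)
  refine CompleteSpace.complete (Metric.cauchy_iff.2 ⟨inferInstance, fun ε hε => ?_⟩)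
  obtain ⟨ζ, hζ, hd⟩ := Metric.dense_iff.1 hs ξ (ε / 4) (by positivity)
  obtain ⟨η, hη⟩ := h ζ hd
  refine ⟨_, image_mem_map (Metric.tendsto_nhds.1 hη (ε / 4) (by positivity)), ?_⟩
  have key : ∀ k, dist ((V k : H →L[ℂ] H) ζ) η < ε / 4 →
      dist ((V k : H →L[ℂ] H) ξ) η < ε / 2 := by
    intro k hk
    have h1 : dist ((V k : H →L[ℂ] H) ξ) ((V k : H →L[ℂ] H) ζ) < ε / 4 := by
      rw [hV, dist_comm]; exact hζ
    linarith [dist_triangle ((V k : H →L[ℂ] H) ξ) ((V k : H →L[ℂ] H) ζ) η]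
  rintro _ ⟨i, hi, rfl⟩ _ ⟨j, hj, rfl⟩
  linarith [key i hi, key j hj,
    dist_triangle_right ((V i : H →L[ℂ] H) ξ) ((V j : H →L[ℂ] H) ξ) η]

/-- The strong limit of a net of unitary involutions is a unitary involution. -/
theorem exists_strong_limit (V : κ → unitary (H →L[ℂ] H)) (hV : ∀ k, V k * V k = 1)
    (s : Set H) (hs : Dense s)
    (h : ∀ ξ ∈ s, ∃ η, Tendsto (fun k => (V k : H →L[ℂ] H) ξ) l (𝓝 η)) :
    ∃ U : unitary (H →L[ℂ] H), U * U = 1 ∧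
      ∀ ξ, Tendsto (fun k => (V k : H →L[ℂ] H) ξ) l (𝓝 ((U : H →L[ℂ] H) ξ)) := by
  choose f hf using unitary_tendsto_of_dense V s hs h
  have hnorm : ∀ ξ, ‖f ξ‖ = ‖ξ‖ := fun ξ =>
    tendsto_nhds_unique (hf ξ).norm (tendsto_const_nhds.congr fun k =>
      (Unitary.norm_map (V k) ξ).symm)
  let L : H →ₗ[ℂ] H :=
    { toFun := f
      map_add' := fun x y => tendsto_nhds_unique (hf (x + y))
        (((hf x).add (hf y)).congr fun k => (map_add _ _ _).symm)
      map_smul' := fun c x => tendsto_nhds_unique (hf (c • x))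
        (((hf x).const_smul c).congr fun k => (map_smul _ _ _).symm) }
  let W : H →L[ℂ] H := L.mkContinuous 1 fun x => by rw [one_mul]; exact (hnorm x).le
  have hW : ∀ ξ, Tendsto (fun k => (V k : H →L[ℂ] H) ξ) l (𝓝 (W ξ)) := hf
  have hVV : ∀ k ξ, (V k : H →L[ℂ] H) ((V k : H →L[ℂ] H) ξ) = ξ := fun k ξ => by
    have := congrArg (fun u : unitary (H →L[ℂ] H) => (u : H →L[ℂ] H) ξ) (hV k)
    exact this
  have hWW : W * W = 1 := by
    ext ξ
    have h1 := hW (W ξ)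
    refine tendsto_nhds_unique h1 ?_
    rw [tendsto_iff_norm_sub_tendsto_zero]
    refine (tendsto_iff_norm_sub_tendsto_zero.1 (hW ξ)).congr fun k => ?_
    -- Since `V k` is an isometric involution, `V k (W ξ)` is as far from `ξ` as `W ξ` is from `V k
    -- ξ`.
    rw [← Unitary.norm_map (V k) ((V k : H →L[ℂ] H) ξ - W ξ), map_sub, hVV, norm_sub_rev]
    rfl
  have hstar : star W = W := by
    rw [ContinuousLinearMap.star_eq_adjoint, eq_comm, ContinuousLinearMap.eq_adjoint_iff]
    intro x y
    refine tendsto_nhds_unique ((hW x).inner tendsto_const_nhds)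
      ((tendsto_const_nhds.inner (hW y)).congr fun k => ?_)
    have := Unitary.inner_map_map (V k) ((V k : H →L[ℂ] H) x) y
    rw [hVV] at this
    exact this
  exact ⟨⟨W, by rw [Unitary.mem_iff, hstar]; exact ⟨hWW, hWW⟩⟩, Subtype.ext hWW, hW⟩

end StrongLimits

/-! ### Strong limits of partial products in the GNS representation -/

section GNS

open scoped ComplexOrder

variable {A : Type*} [CStarAlgebra A] [PartialOrder A] [StarOrderedRing A] (ω : A →ₚ[ℂ] ℂ)
  {ι : Type*}

/-- The GNS vector. -/
def gnsVector : ω.GNS := ((ω.toPreGNS 1 : ω.PreGNS) : ω.GNS)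

theorem gnsStarAlgHom_gnsVector (O : A) :
    ω.gnsStarAlgHom O (gnsVector ω) = ((ω.toPreGNS O : ω.PreGNS) : ω.GNS) := by
  change ω.gnsNonUnitalStarAlgHom O _ = _
  rw [gnsVector, PositiveLinearMap.gnsNonUnitalStarAlgHom_apply_coe]
  simp

theorem gnsVector_cyclic : Dense (Set.range fun O : A => ω.gnsStarAlgHom O (gnsVector ω)) := by
  simp only [gnsStarAlgHom_gnsVector]
  exact (UniformSpace.Completion.denseRange_coe (α := ω.PreGNS)).comp
    ω.toPreGNS.surjective.denseRange (UniformSpace.Completion.continuous_coe _)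

/-- The number assumed to vanish is the squared norm of `(π(O) - 1)Ω`. -/
theorem gnsStarAlgHom_fixes {O : A} (h : ω (star (O - 1) * (O - 1)) = 0) :
    ω.gnsStarAlgHom O (gnsVector ω) = gnsVector ω := by
  rw [gnsStarAlgHom_gnsVector, gnsVector, ← sub_eq_zero, ← UniformSpace.Completion.coe_sub,
    ← norm_eq_zero, UniformSpace.Completion.norm_coe, ← map_sub, PositiveLinearMap.preGNS_norm_def,
    PositiveLinearMap.ofPreGNS_toPreGNS, h]
  simp

/-- Conjugation with a formal product of commuting unitary involutions that fix the GNS vector is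
implemented by a unitary in the bicommutant of the factors. -/
theorem IsFormalAd.exists_implementer {u : ι → unitary A} {hu : ∀ i j, Commute (u i) (u j)}
    {φ : A → A} (h : IsFormalAd u hu φ) (hsq : ∀ i, u i * u i = 1)
    (hω : ∀ i, ω (star ((u i : A) - 1) * ((u i : A) - 1)) = 0) (S : StarSubalgebra ℂ A)
    (hS : ∀ i, (u i : A) ∈ S) :
    ∃ U : unitary (ω.GNS →L[ℂ] ω.GNS), U * U = 1 ∧
      (U : ω.GNS →L[ℂ] ω.GNS) ∈
        Set.centralizer (Set.centralizer (ω.gnsStarAlgHom '' (S : Set A))) ∧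
      ∀ O, (U : ω.GNS →L[ℂ] ω.GNS) * ω.gnsStarAlgHom O * star (U : ω.GNS →L[ℂ] ω.GNS) =
        ω.gnsStarAlgHom (φ O) := by
  let p := partialProd u hu
  let V : Finset ι → unitary (ω.GNS →L[ℂ] ω.GNS) := fun T =>
    ⟨ω.gnsStarAlgHom (p T), Unitary.map_mem ω.gnsStarAlgHom (p T).2⟩
  have hVcoe : ∀ T, (V T : ω.GNS →L[ℂ] ω.GNS) = ω.gnsStarAlgHom (p T) := fun _ => rfl
  have hp : ∀ T, p T * p T = 1 := fun T => by
    have h1 := partialProd_mul u u hu hu hu (commute_mul_family hu hu hu) T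
    rw [← h1]
    exact Finset.noncommProd_induction T _ _ (· = 1) (by rintro a b rfl rfl; simp) rfl
      (fun i _ => hsq i)
  have hpstar : ∀ T, star (p T : A) = p T := fun T => by
    have : (p T)⁻¹ = p T := inv_eq_of_mul_eq_one_left (hp T)
    exact congrArg Subtype.val this
  have hV : ∀ T, V T * V T = 1 := fun T => by
    refine Subtype.ext ?_
    change ω.gnsStarAlgHom (p T : A) * ω.gnsStarAlgHom (p T : A) = 1
    rw [← map_mul, ← Submonoid.coe_mul, hp, OneMemClass.coe_one, map_one]
  have hΩ : ∀ T, ω.gnsStarAlgHom (p T) (gnsVector ω) = gnsVector ω := fun T => by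
    refine Finset.noncommProd_induction T u (fun i _ j _ _ => hu i j)
      (fun V : unitary A => ω.gnsStarAlgHom V (gnsVector ω) = gnsVector ω) ?_ (by simp)
      (fun i _ => gnsStarAlgHom_fixes ω (hω i))
    intro a b ha hb
    rw [Submonoid.coe_mul, map_mul, mul_apply_eq_comp, hb, ha]
  have hcont : Continuous ω.gnsStarAlgHom := map_continuous ω.gnsStarAlgHom
  have hconj : ∀ T O, ω.gnsStarAlgHom (conj (p T) O) =
      V T * ω.gnsStarAlgHom O * V T := fun T O => by
    rw [conj, hpstar, map_mul, map_mul, hVcoe]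
  have happ : ∀ ξ : ω.GNS, Continuous fun L : ω.GNS →L[ℂ] ω.GNS => L ξ := fun ξ =>
    (ContinuousLinearMap.apply ℂ ω.GNS ξ).continuous
  have hconv : ∀ ξ ∈ Set.range fun O : A => ω.gnsStarAlgHom O (gnsVector ω),
      ∃ η, Tendsto (fun T => (V T : ω.GNS →L[ℂ] ω.GNS) ξ) atTop (𝓝 η) := by
    rintro _ ⟨O, rfl⟩
    -- As `V T` is self-adjoint and fixes `Ω`, the vector `V T π(O) Ω` equals `π(Ad(p T) O) Ω`,
    -- which converges because `Ad(p T) O` converges in norm.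
    refine ⟨ω.gnsStarAlgHom (φ O) (gnsVector ω), ?_⟩
    have h1 : Tendsto (fun T => ω.gnsStarAlgHom (conj (p T) O)) atTop
        (𝓝 (ω.gnsStarAlgHom (φ O))) := (hcont.tendsto _).comp (h O)
    refine ((happ (gnsVector ω)).continuousAt.tendsto.comp h1).congr fun T => ?_
    simp only [Function.comp_apply, hconj, mul_apply_eq_comp, hVcoe, hΩ]
  obtain ⟨U, hUU, hU⟩ := exists_strong_limit V hV _ (gnsVector_cyclic ω) hconv
  have hUstar : star (U : ω.GNS →L[ℂ] ω.GNS) = U := by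
    have : U⁻¹ = U := inv_eq_of_mul_eq_one_left hUU
    exact congrArg Subtype.val this
  refine ⟨U, hUU, ?_, fun O => ?_⟩
  · rw [Set.mem_centralizer_iff]
    intro c hc
    -- The partial products lie in `S`, and commutation with `c` survives the strong limit.
    have hcV : ∀ T, c * (V T : ω.GNS →L[ℂ] ω.GNS) = V T * c := fun T => by
      refine ((Set.mem_centralizer_iff.1 hc) _ ⟨p T, ?_, rfl⟩).symm
      exact partialProd_mem hu T fun i _ => hS i
    ext ξ
    refine tendsto_nhds_unique ((c.continuous.tendsto _).comp (hU ξ)) ((hU (c ξ)).congr fun T => ?_)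
    exact (congrArg (fun L : ω.GNS →L[ℂ] ω.GNS => L ξ) (hcV T)).symm
  · rw [hUstar]
    ext ξ
    have h1 : Tendsto (fun T => ω.gnsStarAlgHom (conj (p T) O)) atTop
        (𝓝 (ω.gnsStarAlgHom (φ O))) := (hcont.tendsto _).comp (h O)
    refine tendsto_nhds_unique ?_ ((happ ξ).continuousAt.tendsto.comp h1)
    have h2 : Tendsto (fun T => ω.gnsStarAlgHom O ((V T : ω.GNS →L[ℂ] ω.GNS) ξ)) atTop
        (𝓝 (ω.gnsStarAlgHom O ((U : ω.GNS →L[ℂ] ω.GNS) ξ))) :=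
      ((ω.gnsStarAlgHom O).continuous.tendsto _).comp (hU ξ)
    have h3 := hU (ω.gnsStarAlgHom O ((U : ω.GNS →L[ℂ] ω.GNS) ξ))
    -- The two occurrences of `V T` in `V T π(O) V T ξ` converge jointly: the inner one may be
    -- replaced by its limit because the outer one is isometric.
    have h4 : Tendsto (fun T => (V T : ω.GNS →L[ℂ] ω.GNS)
        (ω.gnsStarAlgHom O ((V T : ω.GNS →L[ℂ] ω.GNS) ξ)) - (V T : ω.GNS →L[ℂ] ω.GNS)
        (ω.gnsStarAlgHom O ((U : ω.GNS →L[ℂ] ω.GNS) ξ))) atTop (𝓝 0) := by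
      rw [tendsto_zero_iff_norm_tendsto_zero]
      refine (tendsto_iff_norm_sub_tendsto_zero.1 h2).congr fun T => ?_
      have e := Unitary.norm_map (V T) (ω.gnsStarAlgHom O ((V T : ω.GNS →L[ℂ] ω.GNS) ξ) -
        ω.gnsStarAlgHom O ((U : ω.GNS →L[ℂ] ω.GNS) ξ))
      rw [map_sub] at e
      exact e.symm
    have h5 := h4.add h3
    simp only [sub_add_cancel, zero_add] at h5
    refine h5.congr fun T => ?_
    simp only [Function.comp_apply, hconj]
    rfl

end GNS

/-! ### Diagonal observables -/

/-- `O` is the multiplication operator with `f` in the basis of string configurations. -/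
def ActsAs (O : QLoc) (f : Config → ℂ) : Prop := ∀ (ψ : Fock) (s : Config), toOp O ψ s = f s * ψ s

theorem ActsAs.one : ActsAs 1 1 := fun ψ s => by simp

theorem ActsAs.mul {O O' : QLoc} {f f' : Config → ℂ} (h : ActsAs O f) (h' : ActsAs O' f') :
    ActsAs (O * O') (f * f') := fun ψ s => by
  rw [map_mul, mul_apply_eq_comp, h, h', Pi.mul_apply, mul_assoc]

theorem ActsAs.ext {O O' : QLoc} {f f' : Config → ℂ} (h : ActsAs O f) (h' : ActsAs O' f')
    (hf : ∀ s, f s = f' s) : O = O' :=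
  ext_op fun ψ s => by rw [h, h', hf]

/-- The observables that are diagonal in the basis of string configurations. -/
def IsDiag (u : unitary QLoc) : Prop := ∃ f, ActsAs u f

theorem IsDiag.one : IsDiag 1 := ⟨1, ActsAs.one⟩

theorem IsDiag.mul {u v : unitary QLoc} (hu : IsDiag u) (hv : IsDiag v) : IsDiag (u * v) :=
  ⟨_, hu.choose_spec.mul hv.choose_spec⟩

theorem IsDiag.commute {u v : unitary QLoc} (hu : IsDiag u) (hv : IsDiag v) : Commute u v :=
  Subtype.ext ((hu.choose_spec.mul hv.choose_spec).ext (hv.choose_spec.mul hu.choose_spec)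
    fun _ => mul_comm _ _)

theorem actsAs_uZ (x : Edge) : ActsAs (uZ x) (fun s => if x ∈ s then -1 else 1) :=
  fun ψ s => opZ_apply x ψ s

theorem actsAs_uPhase (c : unitary ℂ) (x : Edge) :
    ActsAs (uPhase c x) (fun s => if x ∈ s then c else 1) := fun ψ s => by
  have h : toOp (uPhase c x) ψ s = (1 / 2 : ℂ) * (ψ s + opZ x ψ s) +
    ((c : ℂ) / 2) * (ψ s - opZ x ψ s) := rfl
  rw [h, opZ_apply]
  by_cases hx : x ∈ s <;> simp only [hx, if_true, if_false] <;> ring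

theorem actsAs_uSign (x y : Edge) :
    ActsAs (uSign x y) (fun s => if x ∈ s ∧ y ∉ s then -1 else 1) := fun ψ s => by
  have h : toOp (uSign x y) ψ s = ψ s - 2 * (1 / 4 * (ψ s + opZ y ψ s - opZ x (ψ + opZ y ψ) s)) := by
    have h0 : toOp (uSign x y) = 1 - (2 : ℂ) • ((1 / 4 : ℂ) • ((1 - opZ x) * (1 + opZ y))) := rfl
    rw [h0]
    change ψ s - 2 * (1 / 4 * ((ψ + opZ y ψ : Fock) s - opZ x (ψ + opZ y ψ) s)) = _
    rfl
  rw [h, opZ_apply, opZ_apply]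
  have h2 : (ψ + opZ y ψ : Fock) s = ψ s + opZ y ψ s := rfl
  rw [h2, opZ_apply]
  by_cases hx : x ∈ s <;> by_cases hy : y ∈ s <;> simp [hx, hy]
  ring

theorem isDiag_uZ (x : Edge) : IsDiag (uZ x) := ⟨_, actsAs_uZ x⟩

theorem isDiag_uPhase (c : unitary ℂ) (x : Edge) : IsDiag (uPhase c x) := ⟨_, actsAs_uPhase c x⟩

theorem isDiag_uSign (x y : Edge) : IsDiag (uSign x y) := ⟨_, actsAs_uSign x y⟩

theorem uZ_mul_self (x : Edge) : uZ x * uZ x = 1 := Subtype.ext (sigmaZ_mul_self x)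

theorem uX_mul_self (x : Edge) : uX x * uX x = 1 := Subtype.ext (sigmaX_mul_self x)

/-- One sign is negative for `x` occupied and `y` empty, the other for the opposite case, so the
product is negative exactly when one of the two edges is occupied. This is why the L-vertex signs
leave only `σ^Z` in the square. -/
theorem uSign_mul_uSign_swap (x y : Edge) : uSign y x * uSign x y = uZ x * uZ y :=
  Subtype.ext (((actsAs_uSign y x).mul (actsAs_uSign x y)).ext ((actsAs_uZ x).mul (actsAs_uZ y))
    fun s => by
      simp only [Pi.mul_apply]
      by_cases hx : x ∈ s <;> by_cases hy : y ∈ s <;> simp [hx, hy])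

theorem uPhase_mul (c c' : unitary ℂ) (x : Edge) : uPhase c x * uPhase c' x = uPhase (c * c') x :=
  Subtype.ext (((actsAs_uPhase c x).mul (actsAs_uPhase c' x)).ext (actsAs_uPhase (c * c') x)
    fun s => by
      simp only [Pi.mul_apply]; split_ifs <;> simp)

theorem uPhase_one (x : Edge) : uPhase 1 x = 1 :=
  Subtype.ext ((actsAs_uPhase 1 x).ext ActsAs.one fun s => by simp)

theorem uPhase_pow (c : unitary ℂ) (x : Edge) (m : ℕ) : uPhase c x ^ m = uPhase (c ^ m) x := by
  induction m with
  | zero => rw [pow_zero, pow_zero, uPhase_one]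
  | succ m ih => rw [pow_succ, pow_succ, ih, uPhase_mul]

theorem uPhase_of_eq_neg_one (c : unitary ℂ) (hc : (c : ℂ) = -1) (x : Edge) :
    uPhase c x = uZ x :=
  Subtype.ext ((actsAs_uPhase c x).ext (actsAs_uZ x) fun s => by rw [hc])

theorem sigmaX_mul_sigmaZ (x : Edge) : sigmaX x * sigmaZ x = -(sigmaZ x * sigmaX x) :=
  ext_op fun ψ s => by
    have h : toOp (-(sigmaZ x * sigmaX x)) ψ s = -(opZ x (opX x ψ) s) := by
      simp
    rw [h, map_mul, mul_apply_eq_comp, toOp_sigmaX, toOp_sigmaZ, opX_apply, opZ_apply, opZ_apply,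
      opX_apply]
    by_cases hx : x ∈ s <;> simp [hx, Finset.mem_symmDiff]

theorem conj_uX_sigmaZ (x : Edge) : conj (uX x) (sigmaZ x) = -sigmaZ x := by
  change sigmaX x * sigmaZ x * star (sigmaX x) = _
  rw [star_sigmaX, sigmaX_mul_sigmaZ, neg_mul, mul_assoc, sigmaX_mul_self, mul_one]

/-- A nontrivial phase at an edge does not commute with flipping the edge. -/
theorem uPhase_eq_one_of_commute {c : unitary ℂ} {x : Edge}
    (h : Commute (uPhase c x : QLoc) (sigmaX x)) : (c : ℂ) = 1 := by
  -- Creating a string at `x` from the vacuum gives the coefficient `c` or `1`, depending on whether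
  -- the phase is applied after or before the flip.
  have h1 := congrArg (fun O => toOp O vacuum {x}) h.eq
  simp only [map_mul, mul_apply_eq_comp, toOp_sigmaX, opX_apply] at h1
  rw [actsAs_uPhase, actsAs_uPhase, opX_apply] at h1
  simpa [vacuum] using h1

theorem neg_sigmaZ_ne (x : Edge) : -sigmaZ x ≠ sigmaZ x := by
  intro h
  have h1 := congrArg (fun O => toOp O vacuum ∅) h
  have h2 : toOp (-sigmaZ x) vacuum ∅ = -(opZ x vacuum ∅) := by simp
  simp only [h2, toOp_sigmaZ, opZ_apply] at h1
  norm_num [vacuum] at h1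

/-! ### Local algebras -/

theorem sigmaX_mem {X : Set Edge} {x : Edge} (hx : x ∈ X) : sigmaX x ∈ observables X :=
  StarSubalgebra.le_topologicalClosure _ (StarAlgebra.subset_adjoin ℂ _ (Or.inl ⟨x, hx, rfl⟩))

theorem sigmaZ_mem {X : Set Edge} {x : Edge} (hx : x ∈ X) : sigmaZ x ∈ observables X :=
  StarSubalgebra.le_topologicalClosure _ (StarAlgebra.subset_adjoin ℂ _ (Or.inr ⟨x, hx, rfl⟩))

theorem mem_closure_of_mem_observables {X : Set Edge} {O : QLoc} (hO : O ∈ observables X) :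
    O ∈ (StarAlgebra.adjoin ℂ (sigmaX '' X ∪ sigmaZ '' X)).topologicalClosure := by
  have hO : toOp O ∈ (StarAlgebra.adjoin ℂ (paulis X)).topologicalClosure := hO
  have him : toOp '' (sigmaX '' X ∪ sigmaZ '' X) = paulis X := by
    simp only [paulis, Set.image_union, Set.image_image]
    rfl
  rw [← him, ← StarAlgHom.map_adjoin] at hO
  have hind : Topology.IsInducing (toOp : QLoc → (Fock →L[ℂ] Fock)) :=
    Topology.IsInducing.subtypeVal
  change O ∈ closure ((StarAlgebra.adjoin ℂ _ : StarSubalgebra ℂ QLoc) : Set QLoc)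
  rw [hind.closure_eq_preimage_closure_image]
  exact hO

theorem supportedIn_of_generators {w : QLoc ≃⋆ₐ[ℂ] QLoc} {X : Set Edge}
    (hX : ∀ x ∉ X, w (sigmaX x) = sigmaX x) (hZ : ∀ x ∉ X, w (sigmaZ x) = sigmaZ x) :
    SupportedIn w X := fun O hO => by
  refine fixes_of_generators w _ ?_ (mem_closure_of_mem_observables hO)
  rintro _ (⟨x, hx, rfl⟩ | ⟨x, hx, rfl⟩)
  · exact hX x hx
  · exact hZ x hx

/-! ### The factors of the string operators -/

section Strings

variable (c : unitary ℂ) (P : Set Dart)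

theorem isFormalAd_adX : IsFormalAd (xFactor P) (xFactor_comm P) (adX P) :=
  formalAd_isFormalAd _ _ _ _ _

theorem isFormalAd_adLegs : IsFormalAd (legFactor c P) (legFactor_comm c P) (adLegs c P) :=
  formalAd_isFormalAd _ _ _ _ _

theorem isFormalAd_adVertices :
    IsFormalAd (vertexFactor P) (vertexFactor_comm P) (adVertices P) :=
  formalAd_isFormalAd _ _ _ _ _

theorem isFormalAd_adLegsZ : IsFormalAd (legZFactor P) (legZFactor_comm P) (adLegsZ P) :=
  formalAd_isFormalAd _ _ _ _ _

theorem isDiag_legFactor (d : Dart) : IsDiag (legFactor c P d) := by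
  unfold legFactor
  split_ifs
  exacts [isDiag_uPhase _ _, IsDiag.one]

theorem isDiag_vertexFactor (d : Dart) : IsDiag (vertexFactor P d) := by
  unfold vertexFactor
  split_ifs
  exacts [isDiag_uSign _ _, IsDiag.one]

theorem isDiag_legZFactor (d : Dart) : IsDiag (legZFactor P d) := by
  unfold legZFactor
  split_ifs
  exacts [isDiag_uZ _, IsDiag.one]

open Classical in
/-- The factors `(-1) ^ s_v` after flipping the edges of the path. -/
def flippedVertexFactor (d : Dart) : unitary QLoc :=
  if d ∈ P ∧ d.turnRight ∈ P then uSign d.turnRight.edge d.edge else 1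

theorem isDiag_flippedVertexFactor (d : Dart) : IsDiag (flippedVertexFactor P d) := by
  unfold flippedVertexFactor
  split_ifs
  exacts [isDiag_uSign _ _, IsDiag.one]

open Classical in
/-- The factors `σ^Z_j σ^Z_k` for the edges `j`, `k` of the path at an L-vertex. -/
def turnFactor (d : Dart) : unitary QLoc :=
  if d ∈ P ∧ d.turnRight ∈ P then uZ d.edge * uZ d.turnRight.edge else 1

theorem isDiag_turnFactor (d : Dart) : IsDiag (turnFactor P d) := by
  unfold turnFactor
  split_ifs
  exacts [(isDiag_uZ _).mul (isDiag_uZ _), IsDiag.one]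

theorem flippedVertexFactor_mul : flippedVertexFactor P * vertexFactor P = turnFactor P := by
  funext d
  simp only [Pi.mul_apply, flippedVertexFactor, vertexFactor, turnFactor]
  split_ifs
  · exact uSign_mul_uSign_swap _ _
  · exact one_mul 1

theorem uZ_mul_uZ_sq (x y : Edge) : uZ x * uZ y * (uZ x * uZ y) = 1 := by
  rw [((isDiag_uZ y).commute (isDiag_uZ x)).mul_mul_mul_comm, uZ_mul_self, uZ_mul_self, one_mul]

theorem turnFactor_mul_self (d : Dart) : turnFactor P d * turnFactor P d = 1 := by
  unfold turnFactor
  split_ifs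
  · exact uZ_mul_uZ_sq _ _
  · exact one_mul 1

theorem legZFactor_mul_self (d : Dart) : legZFactor P d * legZFactor P d = 1 := by
  unfold legZFactor
  split_ifs
  · exact uZ_mul_self _
  · exact one_mul 1

theorem legFactor_mul_one (c c' : unitary ℂ) (h : (c * c' : ℂ) = 1) :
    legFactor c P * legFactor c' P = 1 := by
  funext d
  simp only [Pi.mul_apply, legFactor, Pi.one_apply]
  split_ifs
  · rw [uPhase_mul, show c * c' = 1 from Subtype.ext h, uPhase_one]
  · exact one_mul 1

theorem legFactor_mul_neg_one (c c' : unitary ℂ) (h : (c * c' : ℂ) = -1) :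
    legFactor c P * legFactor c' P = legZFactor P := by
  funext d
  simp only [Pi.mul_apply, legFactor, legZFactor]
  split_ifs
  · rw [uPhase_mul, uPhase_of_eq_neg_one _ h]
  · exact one_mul 1

theorem legFactor_mul_legZFactor (c c' : unitary ℂ) (h : (c' : ℂ) = -c) :
    legFactor c P * legZFactor P = legFactor c' P := by
  funext d
  simp only [Pi.mul_apply, legFactor, legZFactor]
  split_ifs
  · have hm : ((-1 : unitary ℂ) : ℂ) = -1 := rfl
    rw [← uPhase_of_eq_neg_one (-1) hm, uPhase_mul]
    congr 1
    exact Subtype.ext (by rw [h, Submonoid.coe_mul, hm, mul_neg_one])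
  · exact one_mul 1

theorem xFactor_mul_self (d : Dart) : xFactor P d * xFactor P d = 1 := by
  unfold xFactor
  split_ifs
  · exact uX_mul_self _
  · exact one_mul 1

theorem adX_adX (O : QLoc) : adX P (adX P O) = O :=
  (isFormalAd_adX P).involutive (xFactor_mul_self P) O

theorem adX_symm (O : QLoc) : (adX P).symm O = adX P O := by
  rw [StarAlgEquiv.symm_apply_eq, adX_adX]

theorem adX_sigmaZ_of_notMem {x : Edge} (h : ∀ d ∈ P, d.edge ≠ x) :
    adX P (sigmaZ x) = sigmaZ x := by
  refine (isFormalAd_adX P).fixes fun d => ?_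
  unfold xFactor
  split_ifs with hd
  · exact sigmaX_sigmaZ_comm (h d hd)
  · exact Commute.one_left _

variable {P} {Q : Set Hex}

/-- A path inside a boundary uses each edge in one orientation only, so exactly one factor of `X`
flips this edge. -/
theorem adX_sigmaZ_of_mem (hP : P ⊆ boundary Q) {d : Dart} (hd : d ∈ P) :
    adX P (sigmaZ d.edge) = -sigmaZ d.edge := by
  classical
  rw [(isFormalAd_adX P).eq_conj {d}]
  · rw [partialProd, Finset.noncommProd_singleton, xFactor, if_pos hd, conj_uX_sigmaZ]
  · intro d' hd'
    unfold xFactor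
    split_ifs with h
    · refine sigmaX_sigmaZ_comm fun he => hd' ?_
      rw [boundary_edge_inj (hP h) (hP hd) he]
      exact Finset.mem_singleton_self d
    · exact Commute.one_left _

theorem adX_rightLeg (hP : P ⊆ boundary Q) {d : Dart} (hd : d ∈ P) (hl : d.turnLeft ∈ P) :
    adX P (sigmaZ d.rightLeg) = sigmaZ d.rightLeg :=
  adX_sigmaZ_of_notMem P fun _ hd' => rightLeg_ne_of_boundary (hP hd) (hP hl) (hP hd')

theorem adX_legFactor (hP : P ⊆ boundary Q) (d : Dart) :
    (legFactor c P d : QLoc) = adX P (legFactor c P d) := by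
  unfold legFactor
  split_ifs with h
  · simp [uPhase, adX_rightLeg hP h.1 h.2]
  · simp

theorem adX_legZFactor (hP : P ⊆ boundary Q) (d : Dart) :
    (legZFactor P d : QLoc) = adX P (legZFactor P d) := by
  unfold legZFactor
  split_ifs with h
  · exact (adX_rightLeg hP h.1 h.2).symm
  · simp

/-- Both edges at an L-vertex belong to the path and change sign, which turns `(1 - σ^Z_j)(1 +
σ^Z_k)` into `(1 + σ^Z_j)(1 - σ^Z_k)`. -/
theorem adX_vertexFactor (hP : P ⊆ boundary Q) (d : Dart) :
    (flippedVertexFactor P d : QLoc) = adX P (vertexFactor P d) := by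
  unfold flippedVertexFactor vertexFactor
  split_ifs with h
  · have hc : Commute (1 - sigmaZ d.turnRight.edge) (1 + sigmaZ d.edge) :=
      ((Commute.one_left _).sub_left
        (((Commute.one_right _).add_right (sigmaZ_comm _ _))))
    simp [uSign, adX_sigmaZ_of_mem hP h.1, adX_sigmaZ_of_mem hP h.2, ← sub_eq_add_neg, hc.eq]
  · simp

end Strings

/-! ### Fusion of string automorphisms up to diagonal factors -/

section Fusion

variable {P : Set Dart} {Q : Set Hex}

theorem legFactor_commute_vertexFactor (c : unitary ℂ) (i j : Dart) :
    Commute (legFactor c P i) (vertexFactor P j) :=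
  (isDiag_legFactor c P i).commute (isDiag_vertexFactor P j)

theorem flippedVertexFactor_comm (i j : Dart) :
    Commute (flippedVertexFactor P i) (flippedVertexFactor P j) :=
  (isDiag_flippedVertexFactor P i).commute (isDiag_flippedVertexFactor P j)

/-- The semion string automorphism with the phase `c` at the R-legs. -/
def semionAut (c : unitary ℂ) (P : Set Dart) : QLoc ≃⋆ₐ[ℂ] QLoc :=
  ((adVertices P).trans (adLegs c P)).trans (adX P)

theorem semionAut_apply (c : unitary ℂ) (O : QLoc) :
    semionAut c P O = adX P (adLegs c P (adVertices P O)) := rfl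

theorem isFormalAd_adLegs_adVertices (c : unitary ℂ) :
    IsFormalAd (legFactor c P * vertexFactor P) (commute_mul_family (legFactor_comm c P)
      (vertexFactor_comm P) (legFactor_commute_vertexFactor c)) (adLegs c P ∘ adVertices P) :=
  (isFormalAd_adLegs c P).mul (isFormalAd_adVertices P) (legFactor_commute_vertexFactor c)

/-- With `D` and `D'` the diagonal parts, `X D X D' = (X D X) D'` is diagonal because `X` is an
involution. The leg phases multiply, and each vertex sign meets its flipped version, giving
`turnFactor`. -/
theorem isFormalAd_semionAut_semionAut (hP : P ⊆ boundary Q) (c c' : unitary ℂ)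
    (w : Dart → unitary QLoc) (hw : ∀ i j, Commute (w i) (w j))
    (h : legFactor c P * legFactor c' P * turnFactor P = w) :
    IsFormalAd w hw (fun O => semionAut c P (semionAut c' P O)) := by
  have hcomm : ∀ i j, Commute ((legFactor c P * flippedVertexFactor P) i)
      ((legFactor c P * flippedVertexFactor P) j) :=
    commute_mul_family (legFactor_comm c P) flippedVertexFactor_comm
      fun i j => (isDiag_legFactor c P i).commute (isDiag_flippedVertexFactor P j)
  have h1 := (isFormalAd_adLegs_adVertices (P := P) c).map (adX P) (hv := hcomm) (fun i => by
    rw [Pi.mul_apply, Pi.mul_apply, Submonoid.coe_mul, Submonoid.coe_mul, map_mul,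
      ← adX_legFactor c hP, ← adX_vertexFactor hP])
  have h2 := h1.mul (isFormalAd_adLegs_adVertices (P := P) c') fun i j =>
    ((isDiag_legFactor c P i).mul (isDiag_flippedVertexFactor P i)).commute
      ((isDiag_legFactor c' P j).mul (isDiag_vertexFactor P j))
  have hw' : legFactor c P * flippedVertexFactor P * (legFactor c' P * vertexFactor P) = w := by
    rw [← h, ← flippedVertexFactor_mul]
    funext d
    exact ((isDiag_flippedVertexFactor P d).commute (isDiag_legFactor c' P d)).mul_mul_mul_comm _ _
  subst hw'
  have e : (fun O => semionAut c P (semionAut c' P O)) =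
      (fun x => adX P ((adLegs c P ∘ adVertices P) ((adX P).symm x))) ∘
        (adLegs c' P ∘ adVertices P) := by
    funext O
    simp only [Function.comp_apply, adX_symm]
    rfl
  rw [e]
  exact h2

/-- At each R-leg the phase `c` is multiplied by `-1`. No implementer is needed, the identity holds
in the algebra. -/
theorem semionAut_adLegsZ (c c' : unitary ℂ) (h : (c' : ℂ) = -c) (O : QLoc) :
    semionAut c P (adLegsZ P O) = semionAut c' P O := by
  have h1 := (isFormalAd_adLegs_adVertices (P := P) c).mul (isFormalAd_adLegsZ P)
    fun i j => ((isDiag_legFactor c P i).mul (isDiag_vertexFactor P i)).commute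
      (isDiag_legZFactor P j)
  have h2 := h1.unique (isFormalAd_adLegs_adVertices (P := P) c') (by
    rw [← legFactor_mul_legZFactor P c c' h]
    funext d
    simp only [Pi.mul_apply, mul_assoc]
    rw [((isDiag_vertexFactor P d).commute (isDiag_legZFactor P d)).eq])
  exact congrArg (adX P) (congrFun h2 O)

theorem adLegsZ_adX (hP : P ⊆ boundary Q) (O : QLoc) :
    adLegsZ P (adX P O) = adX P (adLegsZ P O) := by
  have h1 := (isFormalAd_adLegsZ P).map (adX P) (hv := legZFactor_comm P)
    fun i => adX_legZFactor hP i
  have h2 := congrFun (h1.unique (isFormalAd_adLegsZ P) rfl) (adX P O)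
  simp only [adX_symm, adX_adX] at h2
  exact h2.symm

theorem adLegsZ_semionAut (hP : P ⊆ boundary Q) (c c' : unitary ℂ) (h : (c' : ℂ) = -c)
    (O : QLoc) : adLegsZ P (semionAut c P O) = semionAut c' P O := by
  rw [← semionAut_adLegsZ c c' h, semionAut_apply, semionAut_apply, adLegsZ_adX hP]
  have h1 := (isFormalAd_adLegsZ P).mul (isFormalAd_adLegs_adVertices (P := P) c)
    fun i j => (isDiag_legZFactor P i).commute
      ((isDiag_legFactor c P j).mul (isDiag_vertexFactor P j))
  have h2 := (isFormalAd_adLegs_adVertices (P := P) c).mul (isFormalAd_adLegsZ P)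
    fun i j => ((isDiag_legFactor c P i).mul (isDiag_vertexFactor P i)).commute
      (isDiag_legZFactor P j)
  have h3 := h1.unique h2 (funext fun d => ((isDiag_legZFactor P d).commute
    ((isDiag_legFactor c P d).mul (isDiag_vertexFactor P d))).eq)
  exact congrArg (adX P) (congrFun h3 O)

theorem adLegsZ_adLegsZ (O : QLoc) : adLegsZ P (adLegsZ P O) = O :=
  (isFormalAd_adLegsZ P).involutive (legZFactor_mul_self P) O

/-! ### The square of the semion string -/

variable (P)

/-- The factors of the square of the semion string. -/
def squareFactor : Dart → unitary QLoc := legZFactor P * turnFactor P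

theorem isDiag_squareFactor (d : Dart) : IsDiag (squareFactor P d) :=
  (isDiag_legZFactor P d).mul (isDiag_turnFactor P d)

theorem squareFactor_comm (i j : Dart) : Commute (squareFactor P i) (squareFactor P j) :=
  (isDiag_squareFactor P i).commute (isDiag_squareFactor P j)

theorem squareFactor_mul_self (d : Dart) : squareFactor P d * squareFactor P d = 1 := by
  rw [squareFactor, Pi.mul_apply,
    ((isDiag_turnFactor P d).commute (isDiag_legZFactor P d)).mul_mul_mul_comm,
    legZFactor_mul_self, turnFactor_mul_self, one_mul]

/-- The square of the semion string automorphism. -/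
def squareAut (O : QLoc) : QLoc := semionAut phaseI P (semionAut phaseI P O)

variable {P}

theorem isFormalAd_squareAut (hP : P ⊆ boundary Q) :
    IsFormalAd (squareFactor P) (squareFactor_comm P) (squareAut P) :=
  isFormalAd_semionAut_semionAut hP _ _ _ _ (by
    rw [legFactor_mul_neg_one P phaseI phaseI (by simp [phaseI]), squareFactor])

theorem squareAut_squareAut (hP : P ⊆ boundary Q) (O : QLoc) :
    squareAut P (squareAut P O) = O :=
  (isFormalAd_squareAut hP).involutive (squareFactor_mul_self P) O

theorem semionAut_neg_semionAut_neg (hP : P ⊆ boundary Q) (O : QLoc) :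
    semionAut phaseNegI P (semionAut phaseNegI P O) = squareAut P O := by
  refine congrFun ((isFormalAd_semionAut_semionAut hP phaseNegI phaseNegI (squareFactor P)
    (squareFactor_comm P) ?_).unique (isFormalAd_squareAut hP) rfl) O
  rw [legFactor_mul_neg_one P phaseNegI phaseNegI (by simp [phaseNegI]), squareFactor]

/-- When the leg phases cancel, the composition retains only the factors `turnFactor`. These are
involutions, and they cancel against the same factors of the square, leaving the `σ^Z` at the
R-legs. -/
theorem squareAut_semionAut (hP : P ⊆ boundary Q) (c c' : unitary ℂ) (h : (c * c' : ℂ) = 1)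
    (O : QLoc) : squareAut P (semionAut c P (semionAut c' P O)) = adLegsZ P O := by
  have ht : ∀ i j, Commute (turnFactor P i) (turnFactor P j) := fun i j =>
    (isDiag_turnFactor P i).commute (isDiag_turnFactor P j)
  have h1 := isFormalAd_semionAut_semionAut hP c c' (turnFactor P) ht (by
    rw [legFactor_mul_one P c c' h, one_mul])
  have h2 := (isFormalAd_squareAut hP).mul h1 fun i j =>
    (isDiag_squareFactor P i).commute (isDiag_turnFactor P j)
  refine congrFun (h2.unique (isFormalAd_adLegsZ P) (funext fun d => ?_)) O
  rw [squareFactor, Pi.mul_apply, Pi.mul_apply, mul_assoc, turnFactor_mul_self, mul_one]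

/-! ### Telescoping: from the square of the semion string to star operators -/

open Classical in
/-- The occupation signs of the edges of a path. -/
def pathFactor (P : Set Dart) (d : Dart) : unitary QLoc := if d ∈ P then uZ d.edge else 1

theorem isDiag_pathFactor (d : Dart) : IsDiag (pathFactor P d) := by
  unfold pathFactor
  split_ifs
  exacts [isDiag_uZ _, IsDiag.one]

theorem pathFactor_comm (i j : Dart) : Commute (pathFactor P i) (pathFactor P j) :=
  (isDiag_pathFactor i).commute (isDiag_pathFactor j)

theorem pathFactor_mul_self (d : Dart) : pathFactor P d * pathFactor P d = 1 := by
  unfold pathFactor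
  split_ifs
  exacts [uZ_mul_self _, one_mul 1]

theorem pathFactor_local :
    ∀ g ∈ gens, {d | ¬ Commute (pathFactor P d : QLoc) g}.Finite := by
  rintro _ (⟨x, rfl⟩ | ⟨x, rfl⟩) <;> refine (Dart.edge_fiber x).subset fun d hd => ?_ <;>
    by_contra h <;> refine hd ?_ <;> unfold pathFactor <;> split_ifs
  · exact (sigmaX_sigmaZ_comm (Ne.symm h)).symm
  · exact Commute.one_left _
  · exact sigmaZ_comm _ _
  · exact Commute.one_left _

open Classical in
/-- The product of the vertex operators at the R-legs: the factor at an R-leg is the product of the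
three `σ^Z` at the vertex. -/
def starFactor (P : Set Dart) (d : Dart) : unitary QLoc :=
  if d ∈ P ∧ d.turnLeft ∈ P then uZ d.edge * uZ d.turnLeft.edge * uZ d.rightLeg else 1

theorem isDiag_starFactor (d : Dart) : IsDiag (starFactor P d) := by
  unfold starFactor
  split_ifs
  exacts [((isDiag_uZ _).mul (isDiag_uZ _)).mul (isDiag_uZ _), IsDiag.one]

theorem starFactor_comm (i j : Dart) : Commute (starFactor P i) (starFactor P j) :=
  (isDiag_starFactor i).commute (isDiag_starFactor j)

theorem starFactor_mul_self (d : Dart) : starFactor P d * starFactor P d = 1 := by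
  unfold starFactor
  split_ifs
  · rw [((isDiag_uZ _).commute ((isDiag_uZ _).mul (isDiag_uZ _))).mul_mul_mul_comm,
      uZ_mul_self, uZ_mul_uZ_sq, one_mul]
  · exact one_mul 1

open Classical in
/-- The contributions of the ends of a path. -/
def endFactor (Q : Set Hex) (P : Set Dart) (d : Dart) : unitary QLoc :=
  if d ∈ P ↔ next Q d ∈ P then 1 else pathFactor P d * pathFactor P (next Q d)

theorem isDiag_endFactor (d : Dart) : IsDiag (endFactor Q P d) := by
  unfold endFactor
  split_ifs
  exacts [IsDiag.one, (isDiag_pathFactor d).mul (isDiag_pathFactor _)]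

theorem endFactor_comm (i j : Dart) : Commute (endFactor Q P i) (endFactor Q P j) :=
  (isDiag_endFactor i).commute (isDiag_endFactor j)

theorem endFactor_mul_self (d : Dart) : endFactor Q P d * endFactor Q P d = 1 := by
  unfold endFactor
  split_ifs
  · exact one_mul 1
  · rw [((isDiag_pathFactor _).commute (isDiag_pathFactor _)).mul_mul_mul_comm,
      pathFactor_mul_self, pathFactor_mul_self, one_mul]

/-- Along a path the signs of the edges telescope. -/
theorem squareFactor_mul_telescope (hP : P ⊆ boundary Q) :
    squareFactor P * (pathFactor P * (pathFactor P ∘ next Q) * endFactor Q P) = starFactor P := by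
  funext d
  simp only [Pi.mul_apply, Function.comp_apply, squareFactor]
  by_cases hd : d ∈ P
  · by_cases hn : next Q d ∈ P
    · have he : endFactor Q P d = 1 := by simp [endFactor, hd, hn]
      have hp : pathFactor P d = uZ d.edge := by simp [pathFactor, hd]
      have hpn : pathFactor P (next Q d) = uZ (next Q d).edge := by simp [pathFactor, hn]
      rw [he, hp, hpn, mul_one]
      -- Left turn: the two edge signs complete the `σ^Z` of the R-leg to a star operator. Right
      -- turn: they cancel the factor of the L-vertex.
      rcases next_eq_or (hP hd) with h | h <;> rw [h] at hn ⊢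
      · have hr : d.turnRight ∉ P := fun h' => turnRight_notMem_of_turnLeft_mem (hP hn) (hP h')
        simp only [legZFactor, turnFactor, starFactor, hd, hn, hr, and_true, and_false, if_true,
          if_false, mul_one]
        exact (isDiag_uZ _).commute ((isDiag_uZ _).mul (isDiag_uZ _))
      · have hl : d.turnLeft ∉ P := fun h' => turnRight_notMem_of_turnLeft_mem (hP h') (hP hn)
        simp only [legZFactor, turnFactor, starFactor, hd, hn, hl, and_true, and_false, if_true,
          if_false, one_mul]
        exact uZ_mul_uZ_sq _ _
    -- At a last edge of the path `endFactor` removes the superfluous sign; likewise below at an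
    -- edge that precedes a first edge.
    · have hr : d.turnRight ∉ P := fun h' => hn (by rwa [next_eq_turnRight (hP hd) (hP h')])
      have hl : d.turnLeft ∉ P := fun h' => hn (by rwa [next_eq_turnLeft (hP hd) (hP h')])
      have he : endFactor Q P d = pathFactor P d * pathFactor P (next Q d) := by
        simp [endFactor, hd, hn]
      simp only [he, legZFactor, turnFactor, starFactor, hr, hl, and_false, if_false, one_mul]
      rw [((isDiag_pathFactor _).commute (isDiag_pathFactor _)).mul_mul_mul_comm,
        pathFactor_mul_self, pathFactor_mul_self, one_mul]
  · simp only [legZFactor, turnFactor, starFactor, hd, false_and, if_false, one_mul]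
    by_cases hn : next Q d ∈ P
    · have he : endFactor Q P d = pathFactor P d * pathFactor P (next Q d) := by
        simp [endFactor, hd, hn]
      rw [he, ((isDiag_pathFactor _).commute (isDiag_pathFactor _)).mul_mul_mul_comm,
        pathFactor_mul_self, pathFactor_mul_self, one_mul]
    · simp [endFactor, pathFactor, hd, hn]

/-- For a path with finitely many ends, the square of the semion string is the product of the vertex
operators at the R-legs up to a local unitary. -/
theorem exists_isFormalAd_starFactor (hP : P ⊆ boundary Q)
    (hfin : {d | ¬ (d ∈ P ↔ next Q d ∈ P)}.Finite) :
    ∃ φ, IsFormalAd (starFactor P) starFactor_comm φ ∧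
      ∀ O, squareAut P O = φ (conj (partialProd (endFactor Q P) endFactor_comm hfin.toFinset) O) := by
  set D := partialProd (endFactor Q P) endFactor_comm hfin.toFinset with hD
  have hF := formalAd_isFormalAd (pathFactor P) pathFactor_comm gens gens_dense pathFactor_local
  have hE : IsFormalAd (endFactor Q P) endFactor_comm (conj D) := by
    have h1 : ∀ g ∈ gens, {i | ¬ Commute (endFactor Q P i : QLoc) g}.Finite := fun g _ =>
      hfin.subset fun d hd hd' => hd (by
        rw [endFactor, if_pos hd']; exact Commute.one_left g)
    have h2 := formalAd_isFormalAd (endFactor Q P) endFactor_comm gens gens_dense h1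
    have h3 : conj D = formalAd (endFactor Q P) endFactor_comm gens gens_dense h1 := by
      funext x
      refine (h2.eq_conj hfin.toFinset fun i hi => ?_).symm
      have : i ∈ P ↔ next Q i ∈ P := by simpa using hi
      rw [endFactor, if_pos this]
      exact Commute.one_left x
    rw [h3]
    exact h2
  -- Reindexing with the permutation `next Q` does not change the formal product of the edge signs,
  -- so multiplying it with its shift gives the square of an involution. This is the telescoping,
  -- carried out without enumerating the path.
  have hFF := (hF.mul (hF.reindex (next Q)) fun i j =>
    (isDiag_pathFactor i).commute (isDiag_pathFactor _)).mul hE fun i j =>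
      ((isDiag_pathFactor i).mul (isDiag_pathFactor _)).commute (isDiag_endFactor j)
  have hS := (isFormalAd_squareAut hP).mul hFF fun i j =>
    (isDiag_squareFactor P i).commute
      (((isDiag_pathFactor j).mul (isDiag_pathFactor _)).mul (isDiag_endFactor j))
  have hid : formalAd (pathFactor P) pathFactor_comm gens gens_dense pathFactor_local ∘
      formalAd (pathFactor P) pathFactor_comm gens gens_dense pathFactor_local = id :=
    funext fun x => hF.involutive pathFactor_mul_self x
  rw [hid, Function.id_comp] at hS
  refine ⟨squareAut P ∘ conj D, ?_, fun O => ?_⟩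
  · intro x
    refine (hS x).congr fun T => ?_
    congr 2
    exact squareFactor_mul_telescope hP
  · rw [Function.comp_apply, hE.involutive endFactor_mul_self]

end Fusion

/-! ### String configurations in the double semion state are closed -/

theorem Dart.edge_mem_boundaryEdges (R : Finset Hex) (d : Dart) :
    d.edge ∈ boundaryEdges R ↔ ¬ (d.left ∈ R ↔ d.right ∈ R) := by
  simp only [boundaryEdges, Finset.mem_image, Finset.mem_filter, Finset.mem_product,
    Finset.mem_univ, and_true]
  constructor
  · rintro ⟨d', ⟨h1, h2⟩, h⟩
    have h1 : d'.left ∈ R := h1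
    rcases Dart.eq_or_eq_rev h with rfl | rfl
    · tauto
    · rw [Dart.rev_left] at h1
      rw [Dart.rev_right] at h2
      tauto
  · intro h
    by_cases hl : d.left ∈ R
    · exact ⟨d, ⟨hl, by tauto⟩, rfl⟩
    · have hr : d.right ∈ R := by tauto
      refine ⟨d.rev, ⟨hr, by rwa [Dart.rev_right]⟩, d.rev_edge⟩

theorem uX_partialProd_vacuum (S : Finset Edge) :
    toOp (partialProd uX commute_uX S : unitary QLoc) vacuum = lp.single 2 S (1 : ℂ) := by
  classical
  induction S using Finset.induction_on with
  | empty => rw [partialProd_empty, OneMemClass.coe_one, map_one]; rfl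
  | insert a S ha ih =>
    rw [partialProd_insert _ _ _ _ ha, Submonoid.coe_mul, map_mul, mul_apply_eq_comp, ih]
    ext s
    change opX a _ s = _
    rw [opX_apply, lp.single_apply, lp.single_apply]
    have hi : insert a S = S ∆ {a} := by
      ext x
      by_cases hx : x = a <;> simp [Finset.mem_symmDiff, hx, ha]
    have : s ∆ {a} = S ↔ s = insert a S := by
      rw [hi]
      exact ⟨fun h => by simp [← h], fun h => by simp [h]⟩
    simp [Pi.single_apply, this]

/-- Among the three hexagons at a vertex, an even number of pairs is separated by membership in `R`,
so zero or two of the three edges are occupied. -/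
theorem starFactor_loopOp (P : Set Dart) (d : Dart) (R : Finset Hex) :
    toOp (starFactor P d) (toOp (loopOp R) vacuum) = toOp (loopOp R) vacuum := by
  unfold starFactor
  split_ifs with h
  · have hf := ((actsAs_uZ d.edge).mul (actsAs_uZ d.turnLeft.edge)).mul (actsAs_uZ d.rightLeg)
    ext s
    rw [Submonoid.coe_mul, Submonoid.coe_mul, hf, loopOp, uX_partialProd_vacuum]
    by_cases hs : s = boundaryEdges R
    · subst hs
      simp only [Pi.mul_apply, ← Dart.legDart_edge, Dart.edge_mem_boundaryEdges,
        Dart.legDart_left, Dart.legDart_right, Dart.turnLeft_left, Dart.turnLeft_right]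
      by_cases hl : d.left ∈ R <;> by_cases hr : d.right ∈ R <;> by_cases ha : d.ahead ∈ R <;>
        simp [hl, hr, ha]
    · rw [lp.single_apply_ne _ _ _ hs, mul_zero]
  · simp

theorem loopState_starFactor (P : Set Dart) (d : Dart) (R : Finset Hex) :
    loopState R (star ((starFactor P d : QLoc) - 1) * ((starFactor P d : QLoc) - 1)) = 0 := by
  have h : toOp ((starFactor P d : QLoc) - 1) (loopVector R) = 0 := by
    rw [loopVector, map_smul, map_sum, Finset.sum_eq_zero, smul_zero]
    intro T _
    rw [map_smul, map_sub, map_one, sub_apply, starFactor_loopOp]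
    simp
  rw [loopState, map_mul, mul_apply_eq_comp, h, map_zero, inner_zero_right]

/-- The expectation value is exactly zero in every `loopState`, so it vanishes at each weak-* limit
point, whatever the exhausting sequence. -/
theorem IsDoubleSemionState.starFactor {ω : PosFunctional} (hω : IsDoubleSemionState ω)
    (P : Set Dart) (d : Dart) :
    ω (star ((starFactor P d : QLoc) - 1) * ((starFactor P d : QLoc) - 1)) = 0 := by
  obtain ⟨R, -, -, h⟩ := hω
  have h1 := MapClusterPt.continuousAt_comp (continuous_apply
    (star ((DoubleSemion.starFactor P d : QLoc) - 1) *
      ((DoubleSemion.starFactor P d : QLoc) - 1))).continuousAt h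
  have h2 : ((fun f : QLoc → ℂ => f (star ((DoubleSemion.starFactor P d : QLoc) - 1) *
      ((DoubleSemion.starFactor P d : QLoc) - 1))) ∘ fun n O => loopState (R n) O) =
      fun _ => 0 := funext fun n => loopState_starFactor P d (R n)
  rw [h2] at h1
  by_contra hne
  have h3 := mapClusterPt_iff_frequently.1 h1 {0}ᶜ (isOpen_compl_singleton.mem_nhds hne)
  simp at h3

/-! ### Fusion in the GNS representation -/

theorem vonNeumann_mul {ω : PosFunctional} {X : Set Edge} {a b : ω.GNS →L[ℂ] ω.GNS}
    (ha : a ∈ vonNeumann ω X) (hb : b ∈ vonNeumann ω X) : a * b ∈ vonNeumann ω X :=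
  Set.mul_mem_centralizer ha hb

/-- The square is the formal product of the star operators composed with `Ad D`, where `D` collects
the finitely many end signs. The implementer is the strong limit for the star operators times
`π(D)`; both lie in the von Neumann algebra since all edges and R-legs of the path are in `X`. -/
theorem exists_square_implementer {ω : PosFunctional} (hω : IsDoubleSemionState ω) {X : Set Edge}
    {P : Set Dart} {Q : Set Hex} (hP : P ⊆ boundary Q)
    (hfin : {d | ¬ (d ∈ P ↔ next Q d ∈ P)}.Finite) (hX : ∀ d ∈ P, d.edge ∈ X)
    (hleg : ∀ d ∈ P, d.turnLeft ∈ P → d.rightLeg ∈ X) :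
    ∃ U : unitary (ω.GNS →L[ℂ] ω.GNS), (U : ω.GNS →L[ℂ] ω.GNS) ∈ vonNeumann ω X ∧
      ∀ O, (U : ω.GNS →L[ℂ] ω.GNS) * ω.gnsStarAlgHom O * star (U : ω.GNS →L[ℂ] ω.GNS) =
        ω.gnsStarAlgHom (squareAut P O) := by
  obtain ⟨φ, hφ, hsq⟩ := exists_isFormalAd_starFactor hP hfin
  set D := partialProd (endFactor Q P) endFactor_comm hfin.toFinset with hD
  have hp : ∀ d, (pathFactor P d : QLoc) ∈ observables X := fun d => by
    unfold pathFactor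
    split_ifs with h
    · exact sigmaZ_mem (hX d h)
    · exact one_mem _
  have hDX : (D : QLoc) ∈ observables X := partialProd_mem _ _ fun d _ => by
    unfold endFactor
    split_ifs
    · exact one_mem _
    · exact mul_mem (hp _) (hp _)
  obtain ⟨U, -, hUX, hU⟩ := hφ.exists_implementer ω starFactor_mul_self
    (hω.starFactor P) (observables X) fun d => by
      unfold starFactor
      split_ifs with h
      · exact mul_mem (mul_mem (sigmaZ_mem (hX _ h.1)) (sigmaZ_mem (hX _ h.2)))
          (sigmaZ_mem (hleg d h.1 h.2))
      · exact one_mem _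
  let V : unitary (ω.GNS →L[ℂ] ω.GNS) :=
    ⟨ω.gnsStarAlgHom D, Unitary.map_mem ω.gnsStarAlgHom D.2⟩
  refine ⟨U * V, vonNeumann_mul hUX (Set.subset_centralizer_centralizer ⟨D, hDX, rfl⟩),
    fun O => ?_⟩
  rw [hsq, ← hU, conj, map_mul, map_mul, map_star]
  change (U : ω.GNS →L[ℂ] ω.GNS) * ω.gnsStarAlgHom D * _ *
    star ((U : ω.GNS →L[ℂ] ω.GNS) * ω.gnsStarAlgHom D) = _
  rw [star_mul]
  simp only [mul_assoc]

/-- The fusion rules for strings with finitely many ends. -/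
theorem exists_fusion_unitaries {ω : PosFunctional} (hω : IsDoubleSemionState ω) {X : Set Edge}
    {P : Set Dart} {Q : Set Hex} (hP : P ⊆ boundary Q)
    (hfin : {d | ¬ (d ∈ P ↔ next Q d ∈ P)}.Finite) (hX : ∀ d ∈ P, d.edge ∈ X)
    (hleg : ∀ d ∈ P, d.turnLeft ∈ P → d.rightLeg ∈ X) :
    ∃ Ω : Anyon → Anyon → unitary (ω.GNS →L[ℂ] ω.GNS),
      ∀ a b, (Ω a b : ω.GNS →L[ℂ] ω.GNS) ∈ vonNeumann ω X ∧
        ∀ O : QLoc, (Ω a b : ω.GNS →L[ℂ] ω.GNS) *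
          ω.gnsStarAlgHom (stringAut a P (stringAut b P O)) *
            star (Ω a b : ω.GNS →L[ℂ] ω.GNS) = ω.gnsStarAlgHom (stringAut (a * b) P O) := by
  -- One unitary serves all four products of two semion-type strings; the other twelve products are
  -- exact and use `1`.
  obtain ⟨U, hUX, hU⟩ := exists_square_implementer hω hP hfin hX hleg
  have hex : ∀ a b, ∃ W : unitary (ω.GNS →L[ℂ] ω.GNS),
      (W : ω.GNS →L[ℂ] ω.GNS) ∈ vonNeumann ω X ∧
        ∀ O : QLoc, (W : ω.GNS →L[ℂ] ω.GNS) *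
          ω.gnsStarAlgHom (stringAut a P (stringAut b P O)) *
            star (W : ω.GNS →L[ℂ] ω.GNS) = ω.gnsStarAlgHom (stringAut (a * b) P O) := by
    have exact_fusion : ∀ a b, (∀ O, stringAut a P (stringAut b P O) = stringAut (a * b) P O) →
        ∃ W : unitary (ω.GNS →L[ℂ] ω.GNS), (W : ω.GNS →L[ℂ] ω.GNS) ∈ vonNeumann ω X ∧
          ∀ O : QLoc, (W : ω.GNS →L[ℂ] ω.GNS) *
            ω.gnsStarAlgHom (stringAut a P (stringAut b P O)) *
              star (W : ω.GNS →L[ℂ] ω.GNS) = ω.gnsStarAlgHom (stringAut (a * b) P O) :=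
      fun a b h => ⟨1, Set.one_mem_centralizer, fun O => by simp [h]⟩
    have square_fusion : ∀ a b,
        (∀ O, squareAut P (stringAut a P (stringAut b P O)) = stringAut (a * b) P O) →
        ∃ W : unitary (ω.GNS →L[ℂ] ω.GNS), (W : ω.GNS →L[ℂ] ω.GNS) ∈ vonNeumann ω X ∧
          ∀ O : QLoc, (W : ω.GNS →L[ℂ] ω.GNS) *
            ω.gnsStarAlgHom (stringAut a P (stringAut b P O)) *
              star (W : ω.GNS →L[ℂ] ω.GNS) = ω.gnsStarAlgHom (stringAut (a * b) P O) :=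
      fun a b h => ⟨U, hUX, fun O => by rw [hU, h]⟩
    have hI : (phaseNegI : ℂ) = -phaseI := rfl
    have hI' : (phaseI : ℂ) = -phaseNegI := by simp [phaseI, phaseNegI]
    have hII : (phaseI * phaseNegI : ℂ) = 1 := by simp [phaseI, phaseNegI]
    have hII' : (phaseNegI * phaseI : ℂ) = 1 := by simp [phaseI, phaseNegI]
    rintro (_ | _ | _ | _) (_ | _ | _ | _)
    · exact exact_fusion _ _ fun O => rfl
    · exact exact_fusion _ _ fun O => rfl
    · exact exact_fusion _ _ fun O => rfl
    · exact exact_fusion _ _ fun O => rfl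
    · exact exact_fusion _ _ fun O => rfl
    · exact square_fusion _ _ fun O => squareAut_squareAut hP O
    · exact square_fusion _ _ fun O => squareAut_semionAut hP _ _ hII O
    · exact exact_fusion _ _ fun O => semionAut_adLegsZ _ _ hI O
    · exact exact_fusion _ _ fun O => rfl
    · exact square_fusion _ _ fun O => squareAut_semionAut hP _ _ hII' O
    · exact square_fusion _ _ fun O =>
        (congrArg (squareAut P) (semionAut_neg_semionAut_neg hP O)).trans (squareAut_squareAut hP O)
    · exact exact_fusion _ _ fun O => semionAut_adLegsZ _ _ hI' O
    · exact exact_fusion _ _ fun O => rfl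
    · exact exact_fusion _ _ fun O => adLegsZ_semionAut hP _ _ hI O
    · exact exact_fusion _ _ fun O => adLegsZ_semionAut hP _ _ hI' O
    · exact exact_fusion _ _ fun O => adLegsZ_adLegsZ O
  choose Ω hΩ using hex
  exact ⟨Ω, hΩ⟩

/-! ### Supports of string automorphisms -/

section Support

variable {P : Set Dart} {Q : Set Hex} {X : Set Edge}

theorem IsDiag.commute_sigmaZ {u : unitary QLoc} (hu : IsDiag u) (x : Edge) :
    Commute (u : QLoc) (sigmaZ x) := congrArg Subtype.val (hu.commute (isDiag_uZ x)).eq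

theorem adLegs_adVertices_sigmaZ (c : unitary ℂ) (x : Edge) :
    adLegs c P (adVertices P (sigmaZ x)) = sigmaZ x := by
  rw [(isFormalAd_adVertices P).fixes fun d => (isDiag_vertexFactor P d).commute_sigmaZ x,
    (isFormalAd_adLegs c P).fixes fun d => (isDiag_legFactor c P d).commute_sigmaZ x]

theorem adX_sigmaX (x : Edge) : adX P (sigmaX x) = sigmaX x := by
  refine (isFormalAd_adX P).fixes fun d => ?_
  unfold xFactor
  split_ifs
  · exact sigmaX_comm _ _
  · exact Commute.one_left _

theorem adVertices_sigmaX {x : Edge} (hx : ∀ d ∈ P, d.edge ≠ x) :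
    adVertices P (sigmaX x) = sigmaX x := by
  refine (isFormalAd_adVertices P).fixes fun d => ?_
  unfold vertexFactor
  split_ifs with h
  · exact commute_uSign (sigmaX_sigmaZ_comm (hx _ h.1).symm).symm
      (sigmaX_sigmaZ_comm (hx _ h.2).symm).symm
  · exact Commute.one_left _

theorem supportedIn_semionAut (c : unitary ℂ) (hX : ∀ d ∈ P, d.edge ∈ X)
    (hleg : ∀ d ∈ P, d.turnLeft ∈ P → d.rightLeg ∈ X) : SupportedIn (semionAut c P) X := by
  have hne : ∀ x ∉ X, ∀ d ∈ P, d.edge ≠ x := fun x hx d hd h => hx (h ▸ hX d hd)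
  refine supportedIn_of_generators (fun x hx => ?_) fun x hx => ?_
  · rw [semionAut_apply, adVertices_sigmaX (hne x hx), (isFormalAd_adLegs c P).fixes, adX_sigmaX]
    intro d
    unfold legFactor
    split_ifs with h
    · have hne : x ≠ d.rightLeg := fun he => hx (he ▸ hleg d h.1 h.2)
      exact commute_uPhase (sigmaX_sigmaZ_comm hne).symm
    · exact Commute.one_left _
  · rw [semionAut_apply, adLegs_adVertices_sigmaZ, adX_sigmaZ_of_notMem P (hne x hx)]

theorem supportedIn_stringAut (hX : ∀ d ∈ P, d.edge ∈ X)
    (hleg : ∀ d ∈ P, d.turnLeft ∈ P → d.rightLeg ∈ X) (a : Anyon) :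
    SupportedIn (stringAut a P) X := by
  cases a with
  | vac => exact fun O _ => rfl
  | semion => exact supportedIn_semionAut phaseI hX hleg
  | antisemion => exact supportedIn_semionAut phaseNegI hX hleg
  | bound =>
    refine supportedIn_of_generators (fun x hx => (isFormalAd_adLegsZ P).fixes fun d => ?_)
      fun x hx => (isFormalAd_adLegsZ P).fixes fun d => (isDiag_legZFactor P d).commute_sigmaZ x
    unfold legZFactor
    split_ifs with h
    · have hne : x ≠ d.rightLeg := fun he => hx (he ▸ hleg d h.1 h.2)
      exact (sigmaX_sigmaZ_comm hne).symm
    · exact Commute.one_left _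

/-- The string automorphism changes the sign of `σ^Z` at every edge of the path, so no such edge can
lie outside of the support. -/
theorem edge_mem_of_supportedIn (hP : P ⊆ boundary Q) (h : SupportedIn (semionAut phaseI P) X)
    {d : Dart} (hd : d ∈ P) : d.edge ∈ X := by
  by_contra hX
  have h1 := h _ (sigmaZ_mem (show d.edge ∈ Xᶜ from hX))
  rw [semionAut_apply, adLegs_adVertices_sigmaZ, adX_sigmaZ_of_mem hP hd] at h1
  exact neg_sigmaZ_ne _ h1

/-- An edge can be an R-leg at one or both of its vertices, so the phase accumulated there is `i` or
`i ^ 2 = -1`, never `1`. The bound-state string would not suffice, since its phase at a doubly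
occurring leg is `(-1) ^ 2 = 1`. -/
theorem rightLeg_mem_of_supportedIn (hP : P ⊆ boundary Q)
    (h : SupportedIn (semionAut phaseI P) X) {d : Dart} (hd : d ∈ P) (hl : d.turnLeft ∈ P) :
    d.rightLeg ∈ X := by
  classical
  by_contra hX
  have h1 := h _ (sigmaX_mem (show d.rightLeg ∈ Xᶜ from hX))
  -- The vertex signs involve only edges of the path, and an R-leg is none of them, so only the leg
  -- phases act.
  rw [semionAut_apply, adVertices_sigmaX fun d' hd' =>
    rightLeg_ne_of_boundary (hP hd) (hP hl) (hP hd')] at h1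
  replace h1 := congrArg (adX P) h1
  rw [adX_adX, adX_sigmaX] at h1
  set F := (Dart.rightLeg_fiber d.rightLeg).toFinset.filter
    (fun d' => d' ∈ P ∧ d'.turnLeft ∈ P) with hF
  have hFmem : ∀ d', d' ∈ F ↔ d'.rightLeg = d.rightLeg ∧ d' ∈ P ∧ d'.turnLeft ∈ P := by
    simp [hF]
  rw [(isFormalAd_adLegs phaseI P).eq_conj F] at h1
  · have hprod : partialProd (legFactor phaseI P) (legFactor_comm phaseI P) F =
        uPhase phaseI d.rightLeg ^ F.card := by
      refine Finset.noncommProd_eq_pow_card _ _ _ _ fun d' hd' => ?_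
      obtain ⟨he, hm⟩ := (hFmem d').1 hd'
      rw [legFactor, if_pos hm, he]
    rw [hprod, uPhase_pow] at h1
    have hcomm : Commute (uPhase (phaseI ^ F.card) d.rightLeg : QLoc) (sigmaX d.rightLeg) := by
      have h2 : (uPhase (phaseI ^ F.card) d.rightLeg : QLoc) * sigmaX d.rightLeg *
        star (uPhase (phaseI ^ F.card) d.rightLeg : QLoc) = sigmaX d.rightLeg := h1
      have h3 := congrArg (· * (uPhase (phaseI ^ F.card) d.rightLeg : QLoc)) h2
      simp only [mul_assoc, Unitary.coe_star_mul_self, mul_one] at h3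
      exact h3
    have hpow : Complex.I ^ F.card = 1 := by
      have := uPhase_eq_one_of_commute hcomm
      simpa [phaseI] using this
    have hpos : 0 < F.card := Finset.card_pos.2 ⟨d, (hFmem d).2 ⟨rfl, hd, hl⟩⟩
    have hle : F.card ≤ 2 := by
      -- `legDart` orients the leg towards the vertex where it is attached; an edge has only two
      -- orientations.
      have hsub : F.image Dart.legDart ⊆ {d.legDart, d.legDart.rev} := by
        intro e he
        obtain ⟨d', hd', rfl⟩ := Finset.mem_image.1 he
        have : d'.legDart.edge = d.legDart.edge := ((hFmem d').1 hd').1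
        simpa using Dart.eq_or_eq_rev this
      rw [← Finset.card_image_of_injective F Dart.legDart_injective]
      exact (Finset.card_le_card hsub).trans Finset.card_le_two
    have h12 : F.card = 1 ∨ F.card = 2 := by omega
    rcases h12 with h2 | h2 <;> rw [h2] at hpow
    · have := congrArg Complex.re hpow
      simp at this
    · rw [Complex.I_sq] at hpow
      norm_num at hpow
  · intro d' hd'
    unfold legFactor
    split_ifs with hm
    · exact commute_uPhase (sigmaX_sigmaZ_comm fun he => hd' ((hFmem d').2 ⟨he.symm, hm⟩)).symm
    · exact Commute.one_left _

end Support

/-! ### Distances in the honeycomb lattice -/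

theorem center_add (p q : Hex) : center (p + q) = center p + center q := by
  ext i
  fin_cases i <;> simp [center] <;> ring

theorem norm_center_dir (i : Fin 6) : ‖center (dir i)‖ = √3 := by
  have h3 : (√3 : ℝ) ^ 2 = 3 := Real.sq_sqrt (by norm_num)
  rw [EuclideanSpace.norm_eq]
  congr 1
  fin_cases i <;> simp [center, dir, Fin.sum_univ_two] <;> nlinarith

theorem sqrt_three_le_two : (√3 : ℝ) ≤ 2 := by
  rw [Real.sqrt_le_left (by norm_num)]
  norm_num

namespace Dart

theorem edge_pos (d : Dart) : d.edge.pos = midpoint ℝ (center d.left) (center d.right) := by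
  have h : (ofEdge d.edge).edge.pos = midpoint ℝ (center (ofEdge d.edge).left)
      (center (ofEdge d.edge).right) := by
    obtain ⟨p, i⟩ := d.edge
    fin_cases i <;> rfl
  rcases eq_ofEdge_or d with h1 | h1
  · rwa [← h1] at h
  · have h2 : ofEdge d.edge = d.rev := by
      conv_rhs => rw [h1]
      rw [rev_rev]
    rw [h2, rev_edge, rev_left, rev_right] at h
    rw [h, midpoint_comm]

theorem edge_pos_eq (d : Dart) :
    d.edge.pos = center d.right + (1 / 2 : ℝ) • center (dir (d.2 + 3)) := by
  have h : center d.left = center d.right + center (dir (d.2 + 3)) := by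
    rw [← center_add, ← rev_right d]
    rfl
  rw [edge_pos, h, midpoint_eq_smul_add, invOf_eq_inv]
  module

theorem dist_right (d : Dart) : dist d.edge.pos (center d.right) ≤ 1 := by
  rw [edge_pos_eq, dist_eq_norm, add_sub_cancel_left, norm_smul, norm_center_dir]
  norm_num
  linarith [sqrt_three_le_two]

theorem dist_left (d : Dart) : dist d.edge.pos (center d.left) ≤ 1 := by
  have := dist_right d.rev
  rwa [rev_edge, rev_right] at this

theorem dist_turnLeft (d : Dart) : dist d.edge.pos d.turnLeft.edge.pos ≤ 2 := by
  have h1 := dist_left d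
  have h2 := dist_left d.turnLeft
  rw [turnLeft_left] at h2
  linarith [dist_triangle_right d.edge.pos d.turnLeft.edge.pos (center d.left)]

theorem dist_turnRight (d : Dart) : dist d.edge.pos d.turnRight.edge.pos ≤ 2 := by
  have h1 := dist_right d
  have h2 := dist_right d.turnRight
  rw [turnRight_right] at h2
  linarith [dist_triangle_right d.edge.pos d.turnRight.edge.pos (center d.right)]

theorem dist_rightLeg (d : Dart) : dist d.edge.pos d.rightLeg.pos ≤ 2 := by
  have h1 := dist_right d
  have h2 := dist_left d.legDart
  rw [legDart_left, legDart_edge] at h2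
  linarith [dist_triangle_right d.edge.pos d.rightLeg.pos (center d.right)]

end Dart

theorem finite_center_dist_le (a : Plane) (M : ℝ) : {p : Hex | dist (center p) a ≤ M}.Finite := by
  set N : ℤ := ⌈2 * M + |a 0| + |a 1|⌉ with hN
  refine ((Set.finite_Icc (-N) N).prod (Set.finite_Icc (-N) N)).subset ?_
  rintro ⟨p, q⟩ h
  have h : dist (center (p, q)) a ≤ M := h
  have hM : 0 ≤ M := dist_nonneg.trans h
  have h0 : |√3 * p + √3 / 2 * q - a 0| ≤ M := by
    have := (PiLp.norm_apply_le (center (p, q) - a) 0).trans ((dist_eq_norm _ _).symm.le.trans h)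
    simpa [center] using this
  have h1 : |3 / 2 * (q : ℝ) - a 1| ≤ M := by
    have := (PiLp.norm_apply_le (center (p, q) - a) 1).trans ((dist_eq_norm _ _).symm.le.trans h)
    simpa [center] using this
  have hs : (1 : ℝ) ≤ √3 := by rw [Real.one_le_sqrt]; norm_num
  have hs2 := sqrt_three_le_two
  have hq : |(q : ℝ)| ≤ M + |a 1| := by
    have e1 : |3 / 2 * (q : ℝ)| ≤ M + |a 1| := by
      have := abs_sub_abs_le_abs_sub (3 / 2 * (q : ℝ)) (a 1)
      linarith
    rw [abs_mul, abs_of_pos (by norm_num : (0 : ℝ) < 3 / 2)] at e1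
    linarith [abs_nonneg (q : ℝ)]
  have hp : |(p : ℝ)| ≤ 2 * M + |a 0| + |a 1| := by
    have e1 : |√3 * (p : ℝ)| ≤ M + |a 0| + |√3 / 2 * (q : ℝ)| := by
      have e2 := abs_sub_abs_le_abs_sub (√3 * (p : ℝ)) (a 0 - √3 / 2 * q)
      have e3 := abs_sub (a 0) (√3 / 2 * (q : ℝ))
      rw [show √3 * (p : ℝ) - (a 0 - √3 / 2 * q) = √3 * p + √3 / 2 * q - a 0 by ring] at e2
      linarith
    rw [abs_mul, abs_mul, abs_of_nonneg (by positivity : (0 : ℝ) ≤ √3),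
      abs_of_nonneg (by positivity : (0 : ℝ) ≤ √3 / 2)] at e1
    nlinarith [abs_nonneg (q : ℝ), abs_nonneg (p : ℝ)]
  have hle : ∀ m : ℤ, |(m : ℝ)| ≤ 2 * M + |a 0| + |a 1| → m ∈ Set.Icc (-N) N := by
    intro m hm
    have : ((|m| : ℤ) : ℝ) ≤ N := by
      rw [Int.cast_abs]
      exact hm.trans (Int.le_ceil _)
    exact abs_le.1 (by exact_mod_cast this)
  exact ⟨hle p hp, hle q (hq.trans (by linarith [abs_nonneg (a 0)]))⟩

theorem finite_edge_dist_le (a : Plane) (M : ℝ) : {d : Dart | dist d.edge.pos a ≤ M}.Finite := by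
  refine ((finite_center_dist_le a (M + 1)).prod (Set.finite_univ (α := Fin 6))).subset ?_
  intro (d : Dart) hd
  have hd : dist d.edge.pos a ≤ M := hd
  refine ⟨?_, trivial⟩
  change dist (center d.left) a ≤ M + 1
  linarith [d.dist_left, dist_triangle_left (center d.left) a d.edge.pos]

/-- The circumradius is `1`; the cruder bound `2` is enough below. -/
theorem dist_center_le_of_mem_hexagon {p : Hex} {x : Plane} (hx : x ∈ hexagon p) :
    dist x (center p) ≤ 2 := by
  have h : ∀ i, inner ℝ (x - center p) (center (dir i)) < 3 / 2 := fun i => by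
    have := hx i
    rwa [center_add, add_sub_cancel_left] at this
  rw [dist_eq_norm]
  set y := x - center p
  have h3 : (√3 : ℝ) ^ 2 = 3 := Real.sq_sqrt (by norm_num)
  have e0 := h 0
  have e1 := h 1
  have e2 := h 2
  have e3 := h 3
  have e4 := h 4
  have e5 := h 5
  simp only [center, dir, PiLp.inner_apply, Fin.sum_univ_two] at e0 e1 e2 e3 e4 e5
  simp at e0 e1 e2 e3 e4 e5
  have hb : |y 1| ≤ 1 := abs_le.2 ⟨by linarith, by linarith⟩
  have ha : (√3 * y 0) ^ 2 ≤ (3 / 2) ^ 2 := sq_le_sq.2 (by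
    rw [abs_of_pos (by norm_num : (0 : ℝ) < 3 / 2)]
    exact abs_le.2 ⟨by linarith, by linarith⟩)
  rw [EuclideanSpace.norm_eq, Real.sqrt_le_left (by norm_num)]
  simp only [Fin.sum_univ_two, Real.norm_eq_abs, sq_abs]
  nlinarith [sq_abs (y 1), abs_nonneg (y 1)]

/-! ### Geometry of cones -/

namespace Cone

variable (K c : Cone)

/-- The coordinate of a point along the axis of a cone. -/
def along (x : Plane) : ℝ := K.axis 0 * (x - K.apex) 0 + K.axis 1 * (x - K.apex) 1

/-- The coordinate of a point across the axis of a cone, positive on the left of the axis. -/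
def across (x : Plane) : ℝ := K.axis 0 * (x - K.apex) 1 - K.axis 1 * (x - K.apex) 0

theorem axis_sq : K.axis 0 ^ 2 + K.axis 1 ^ 2 = 1 := by
  have h := K.norm_axis
  rw [EuclideanSpace.norm_eq, Real.sqrt_eq_one] at h
  simpa [Fin.sum_univ_two] using h

theorem dist_sq_eq (x y : Plane) : dist x y ^ 2 = (x 0 - y 0) ^ 2 + (x 1 - y 1) ^ 2 := by
  rw [EuclideanSpace.dist_eq, Real.sq_sqrt (by positivity)]
  simp [Fin.sum_univ_two, Real.dist_eq, sq_abs]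

theorem along_sub_sq (x y : Plane) :
    (K.along x - K.along y) ^ 2 + (K.across x - K.across y) ^ 2 = dist x y ^ 2 := by
  rw [dist_sq_eq]
  simp only [along, across, PiLp.sub_apply]
  linear_combination ((x 0 - y 0) ^ 2 + (x 1 - y 1) ^ 2) * K.axis_sq

theorem along_apex : K.along K.apex = 0 := by simp [along]

theorem across_apex : K.across K.apex = 0 := by simp [across]

theorem along_sq_add (x : Plane) : K.along x ^ 2 + K.across x ^ 2 = dist x K.apex ^ 2 := by
  simpa [along_apex, across_apex] using K.along_sub_sq x K.apex

theorem abs_along_sub_le (x y : Plane) : |K.along x - K.along y| ≤ dist x y :=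
  abs_le_of_sq_le_sq (by linarith [K.along_sub_sq x y, sq_nonneg (K.across x - K.across y)])
    dist_nonneg

theorem abs_across_sub_le (x y : Plane) : |K.across x - K.across y| ≤ dist x y :=
  abs_le_of_sq_le_sq (by linarith [K.along_sub_sq x y, sq_nonneg (K.along x - K.along y)])
    dist_nonneg

theorem dist_apex_le (x : Plane) : dist x K.apex ≤ |K.along x| + |K.across x| := by
  refine abs_le_of_sq_le_sq' ?_ (by positivity) |>.2
  rw [← along_sq_add, add_sq, sq_abs, sq_abs]
  nlinarith [abs_nonneg (K.along x), abs_nonneg (K.across x)]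

theorem mem_region_iff (x : Plane) :
    x ∈ K.region ↔ dist x K.apex * Real.cos (K.angle / 2) < K.along x := by
  have h : inner ℝ (x - K.apex) K.axis = K.along x := by
    simp [PiLp.inner_apply, Fin.sum_univ_two, along]
  rw [region, Set.mem_ofPred_eq, h, dist_eq_norm]

theorem isOpen_region : IsOpen K.region :=
  isOpen_lt (by fun_prop) (by fun_prop)

variable {K}

theorem cos_pos_of_angle_lt (hK : K.angle < Real.pi) : 0 < Real.cos (K.angle / 2) :=
  Real.cos_pos_of_mem_Ioo ⟨by linarith [K.angle_pos, Real.pi_pos], by linarith⟩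

theorem sin_pos : 0 < Real.sin (K.angle / 2) :=
  Real.sin_pos_of_pos_of_lt_pi (by linarith [K.angle_pos]) (by linarith [K.angle_lt])

/-- A cone with opening angle less than `π` is the intersection of two half-planes. -/
theorem mem_region_iff_of_angle_lt (hK : K.angle < Real.pi) (x : Plane) :
    x ∈ K.region ↔
      |K.across x| * Real.cos (K.angle / 2) < K.along x * Real.sin (K.angle / 2) := by
  have hc := cos_pos_of_angle_lt hK
  have hs := K.sin_pos
  have h1 := K.along_sq_add x
  have h2 := Real.sin_sq_add_cos_sq (K.angle / 2)
  rw [mem_region_iff]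
  set C := Real.cos (K.angle / 2)
  set S := Real.sin (K.angle / 2)
  -- Both inequalities can be squared, and by Pythagoras the squared versions have the same
  -- difference of sides.
  have key : (K.along x * S) ^ 2 - (|K.across x| * C) ^ 2 =
      K.along x ^ 2 - (dist x K.apex * C) ^ 2 := by
    rw [mul_pow, mul_pow, mul_pow, sq_abs]
    linear_combination (K.along x ^ 2) * h2 - C ^ 2 * h1
  constructor
  · intro h
    have hpos : 0 < K.along x := lt_of_le_of_lt (by positivity) h
    refine lt_of_pow_lt_pow_left₀ 2 (by positivity) ?_
    have := pow_lt_pow_left₀ h (by positivity) two_ne_zero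
    linarith
  · intro h
    have hpos : 0 < K.along x := by
      by_contra hn
      have : K.along x * S ≤ 0 := mul_nonpos_of_nonpos_of_nonneg (not_lt.1 hn) hs.le
      have : 0 ≤ |K.across x| * C := by positivity
      linarith
    refine lt_of_pow_lt_pow_left₀ 2 hpos.le ?_
    have := pow_lt_pow_left₀ h (by positivity) two_ne_zero
    linarith

theorem along_pos_of_mem (hK : K.angle < Real.pi) {x : Plane} (hx : x ∈ K.region) :
    0 < K.along x := by
  rw [mem_region_iff] at hx
  exact lt_of_le_of_lt (mul_nonneg dist_nonneg (cos_pos_of_angle_lt hK).le) hx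

/-- The boundary edges of the hexagons overlapping a cone are outside of the cone. -/
theorem pos_notMem_region {d : Dart} (hd : d ∈ boundary K.hexes) : d.edge.pos ∉ K.region := by
  intro h
  obtain ⟨r, hr, hball⟩ := Metric.isOpen_iff.1 K.isOpen_region _ h
  refine hd.2 ?_
  set v := center (dir (d.2 + 3)) with hv
  have hvn : ‖v‖ = √3 := norm_center_dir _
  have h3 : (√3 : ℝ) * √3 = 3 := Real.mul_self_sqrt (by norm_num)
  set δ := min (1 / 4) (r / 4) with hδ
  have hδ0 : 0 < δ := by positivity
  have hδ1 : δ ≤ 1 / 4 := min_le_left _ _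
  have hδ2 : δ ≤ r / 4 := min_le_right _ _
  -- The cone is open, so it also contains a point slightly displaced from the midpoint towards the
  -- center of `d.right`. That point is inside the open hexagon `d.right`, which therefore overlaps
  -- with the cone.
  refine ⟨center d.right + (1 / 2 - δ) • v, fun i => ?_, hball ?_⟩
  · rw [center_add, add_sub_cancel_left, add_sub_cancel_left, real_inner_smul_left]
    have h1 : inner ℝ v (center (dir i)) ≤ 3 := by
      refine (real_inner_le_norm _ _).trans ?_
      rw [hvn, norm_center_dir, h3]
    nlinarith
  · rw [Metric.mem_ball, d.edge_pos_eq, dist_eq_norm, add_sub_add_left_eq_sub, ← sub_smul,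
      norm_smul, hvn, Real.norm_eq_abs, show (1 / 2 - δ - 1 / 2 : ℝ) = -δ by ring, abs_neg,
      abs_of_pos hδ0]
    nlinarith [sqrt_three_le_two]

/-- The boundary edges of the hexagons overlapping a cone are close to the cone. -/
theorem exists_mem_region_dist_le {d : Dart} (hd : d ∈ boundary K.hexes) :
    ∃ y ∈ K.region, dist d.edge.pos y ≤ 3 := by
  obtain ⟨y, hy, hyK⟩ := hd.1
  refine ⟨y, hyK, ?_⟩
  linarith [dist_triangle_right d.edge.pos y (center d.left), d.dist_left,
    dist_center_le_of_mem_hexagon hy]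

theorem leftPath_subset (n : ℝ) : K.leftPath n ⊆ boundary K.hexes := fun _ hd => hd.1

theorem mem_leftPath_iff {n : ℝ} {d : Dart} : d ∈ K.leftPath n ↔
    d ∈ boundary K.hexes ∧ n < dist d.edge.pos K.apex ∧ 0 < K.across d.edge.pos := Iff.rfl

theorem dist_next_le (Q : Set Hex) (d : Dart) :
    dist d.edge.pos (next Q d).edge.pos ≤ 2 := by
  by_cases hd : d ∈ boundary Q
  · rcases next_eq_or hd with h | h <;> rw [h]
    exacts [d.dist_turnLeft, d.dist_turnRight]
  · rw [next_of_notMem hd, dist_self]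
    norm_num

/-- The path along the left leg ends close to the apex. -/
theorem dist_apex_le_of_end (hK : K.angle < Real.pi) {n : ℝ} {d d' : Dart}
    (hd : d ∈ K.leftPath n) (hd' : d' ∈ boundary K.hexes) (hn : d' ∉ K.leftPath n)
    (h : dist d.edge.pos d'.edge.pos ≤ 2) :
    dist d.edge.pos K.apex ≤ |n| + 2 / Real.sin (K.angle / 2) + 5 := by
  have hs := K.sin_pos
  have hc := cos_pos_of_angle_lt hK
  have hs2 : 0 < 2 / Real.sin (K.angle / 2) := by positivity
  obtain ⟨hdb, -, hx⟩ := mem_leftPath_iff.1 hd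
  by_cases hdist : dist d'.edge.pos K.apex ≤ n
  · linarith [dist_triangle d.edge.pos d'.edge.pos K.apex, le_abs_self n]
  -- Otherwise `d'` has crossed the axis, so `d` is within `2` of the axis. Being outside of the
  -- cone bounds its coordinate along the axis above by `2 / sin`, and being within `3` of the cone
  -- bounds it below by `-3`.
  · have hx' : K.across d'.edge.pos ≤ 0 := by
      by_contra hx'
      exact hn (mem_leftPath_iff.2 ⟨hd', not_le.1 hdist, not_le.1 hx'⟩)
    have h1 := (abs_le.1 (K.abs_across_sub_le d.edge.pos d'.edge.pos)).2
    have h2 : ¬ _ := (mem_region_iff_of_angle_lt hK _).not.1 (pos_notMem_region hdb)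
    rw [not_lt, abs_of_pos hx] at h2
    obtain ⟨y, hy, hdy⟩ := exists_mem_region_dist_le hdb
    have h3 := along_pos_of_mem hK hy
    have h4 := (abs_le.1 (K.abs_along_sub_le d.edge.pos y)).1
    have h5 : K.along d.edge.pos ≤ 2 / Real.sin (K.angle / 2) := by
      rw [le_div_iff₀ hs]
      nlinarith [Real.cos_le_one (K.angle / 2)]
    have h6 : |K.along d.edge.pos| ≤ 2 / Real.sin (K.angle / 2) + 3 :=
      abs_le.2 ⟨by linarith, by linarith⟩
    have h7 := K.dist_apex_le d.edge.pos
    rw [abs_of_pos hx] at h7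
    linarith [abs_nonneg n]

/-- The path along the left leg has finitely many ends. -/
theorem finite_ends (hK : K.angle < Real.pi) (n : ℝ) :
    {d | ¬ (d ∈ K.leftPath n ↔ next K.hexes d ∈ K.leftPath n)}.Finite := by
  -- The radius of `dist_apex_le_of_end`, enlarged by `2` because the edge of the pair that lies in
  -- the path may be the successor.
  refine (finite_edge_dist_le K.apex (|n| + 2 / Real.sin (K.angle / 2) + 7)).subset ?_
  intro d hd
  change dist d.edge.pos K.apex ≤ _
  have h2 := dist_next_le K.hexes d
  by_cases hb : d ∈ boundary K.hexes
  · have hb' := next_mem_boundary hb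
    by_cases hm : d ∈ K.leftPath n
    · have := dist_apex_le_of_end hK hm hb' (fun h => hd (iff_of_true hm h)) h2
      linarith
    · have hm' : next K.hexes d ∈ K.leftPath n := by
        by_contra h
        exact hd (iff_of_false hm h)
      have := dist_apex_le_of_end hK hm' hb hm (by rwa [dist_comm])
      linarith [dist_triangle d.edge.pos (next K.hexes d).edge.pos K.apex]
  · exact absurd (by rw [next_of_notMem hb]) hd

/-! ### The path along the axis of a cone and admissible truncations -/

theorem rightHalf_angle_lt : c.rightHalf.angle < Real.pi := by
  have := c.angle_lt
  change c.angle / 2 < _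
  linarith

theorem along_rightHalf (x : Plane) : c.rightHalf.along x =
    Real.cos (c.angle / 4) * c.along x - Real.sin (c.angle / 4) * c.across x := by
  simp [along, across, rightHalf, rotate]
  ring

theorem across_rightHalf (x : Plane) : c.rightHalf.across x =
    Real.sin (c.angle / 4) * c.along x + Real.cos (c.angle / 4) * c.across x := by
  simp [along, across, rightHalf, rotate]
  ring

/-- The distance beyond which the path is well inside of the cone. -/
def admissibleBound : ℝ :=
  7 + 3 / Real.cos (c.angle / 4) + 5 / Real.sin (c.angle / 4) ^ 2

/-- Far away from the apex, the sites near the path are in the cone. -/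
theorem mem_region_of_dist_le {n : ℝ} (hn : c.admissibleBound ≤ n) {d : Dart} (hd : d ∈ c.path n)
    {x : Plane} (hx : dist d.edge.pos x ≤ 2) : x ∈ c.region := by
  have hK := c.rightHalf_angle_lt
  have hangle : c.rightHalf.angle / 2 = c.angle / 4 := by
    change c.angle / 2 / 2 = _
    ring
  have hC := cos_pos_of_angle_lt hK
  have hS := c.rightHalf.sin_pos
  obtain ⟨hb, hdn, hac⟩ := mem_leftPath_iff.1 hd
  have hout := (mem_region_iff_of_angle_lt hK _).not.1 (pos_notMem_region hb)
  obtain ⟨y, hy, hdy⟩ := exists_mem_region_dist_le hb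
  have hypos := along_pos_of_mem hK hy
  have hyin := (mem_region_iff_of_angle_lt hK _).1 hy
  rw [hangle] at hC hS hout hyin
  rw [not_lt, abs_of_pos hac] at hout
  have hsc := Real.sin_sq_add_cos_sq (c.angle / 4)
  have hcos : Real.cos (c.angle / 2) = 1 - 2 * Real.sin (c.angle / 4) ^ 2 := by
    rw [show c.angle / 2 = 2 * (c.angle / 4) by ring, Real.cos_two_mul]
    linarith
  have hyin' : c.rightHalf.across y * Real.cos (c.angle / 4) <
      c.rightHalf.along y * Real.sin (c.angle / 4) :=
    (mul_le_mul_of_nonneg_right (le_abs_self _) hC.le).trans_lt hyin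
  rw [along_rightHalf, across_rightHalf] at hyin' hout
  rw [along_rightHalf] at hypos
  unfold admissibleBound at hn
  have hdn : n < dist d.edge.pos c.apex := hdn
  rw [mem_region_iff, hcos]
  set C := Real.cos (c.angle / 4)
  set S := Real.sin (c.angle / 4)
  -- The summand `3 / C` of the bound excludes that the path lies behind the apex; the summand `5 /
  -- S ^ 2` gives the room needed around the path inside the cone.
  have hn1 : 3 < (n - 6) * C := by
    have : (1 + 3 / C) * C ≤ (n - 6) * C :=
      mul_le_mul_of_nonneg_right (by linarith [div_pos (by norm_num : (0 : ℝ) < 5) (pow_pos hS 2)])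
        hC.le
    have h2 : (1 + 3 / C) * C = C + 3 := by field_simp
    linarith
  have hn2 : 5 ≤ (n - 5) * S ^ 2 := by
    have : 5 / S ^ 2 * S ^ 2 ≤ (n - 5) * S ^ 2 :=
      mul_le_mul_of_nonneg_right (by linarith [div_pos (by norm_num : (0 : ℝ) < 3) hC])
        (pow_pos hS 2).le
    rwa [div_mul_cancel₀ _ (pow_pos hS 2).ne'] at this
  have hn7 : 7 ≤ n := by
    linarith [div_pos (by norm_num : (0 : ℝ) < 3) hC,
      div_pos (by norm_num : (0 : ℝ) < 5) (pow_pos hS 2)]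
  -- The left leg of the half-cone is the axis of `c`: the edge is outside of the half-cone, beyond
  -- this leg, while the nearby point `y` is inside. So the edge is at most `3` to the left of the
  -- axis.
  have ht0 : 0 ≤ c.across d.edge.pos := by
    have : (S * c.along d.edge.pos + C * c.across d.edge.pos) * C -
      (C * c.along d.edge.pos - S * c.across d.edge.pos) * S = c.across d.edge.pos := by
      linear_combination c.across d.edge.pos * hsc
    linarith
  have hty : c.across y < 0 := by
    have : (S * c.along y + C * c.across y) * C -
      (C * c.along y - S * c.across y) * S = c.across y := by
      linear_combination c.across y * hsc
    linarith
  have hdty := abs_le.1 ((c.abs_across_sub_le d.edge.pos y).trans hdy)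
  have hdsy := abs_le.1 ((c.abs_along_sub_le d.edge.pos y).trans hdy)
  have hsq := c.along_sq_add d.edge.pos
  have hsq' : (n - 3) ^ 2 ≤ c.along d.edge.pos ^ 2 := by nlinarith
  -- An edge at distance more than `n` from the apex and within `3` of the axis is far out along the
  -- axis. The opposite direction is impossible because it would also put `y` behind the apex.
  have hs : n - 3 ≤ c.along d.edge.pos := by
    rcases le_or_gt 0 (c.along d.edge.pos) with h | h
    · exact le_of_sq_le_sq hsq' h
    · exfalso
      have h1 : n - 3 ≤ -c.along d.edge.pos :=
        le_of_sq_le_sq (by rwa [neg_sq]) (by linarith)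
      have hS1 : S ≤ 1 := Real.sin_le_one _
      nlinarith
  have hxs := abs_le.1 ((c.abs_along_sub_le d.edge.pos x).trans hx)
  have hxt := abs_le.1 ((c.abs_across_sub_le d.edge.pos x).trans hx)
  have hxpos : 0 < c.along x := by linarith
  have hdx : dist x c.apex ≤ c.along x + 5 := by
    have h1 := c.dist_apex_le x
    rw [abs_of_pos hxpos] at h1
    have h2 : |c.across x| ≤ 5 := abs_le.2 ⟨by linarith, by linarith⟩
    linarith
  -- Here `1 - 2 * S ^ 2` is the cosine of half the opening angle. If it is negative, a positive
  -- coordinate along the axis is enough; otherwise `(along + 5) * (1 - 2 * S ^ 2) < along` follows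
  -- from `5 ≤ along * S ^ 2`.
  rcases le_or_gt 0 (1 - 2 * S ^ 2) with hk | hk
  · have h1 := mul_le_mul_of_nonneg_right hdx hk
    have h2 : (n - 5) * S ^ 2 ≤ c.along x * S ^ 2 :=
      mul_le_mul_of_nonneg_right (by linarith) (pow_pos hS 2).le
    nlinarith [pow_pos hS 2]
  · exact (mul_nonpos_of_nonneg_of_nonpos dist_nonneg hk.le).trans_lt hxpos

theorem admissible_of_bound_le {n : ℝ} (hn : c.admissibleBound ≤ n) : c.Admissible n := by
  refine ⟨?_, supportedIn_stringAut (fun d hd => ?_) fun d hd _ => ?_⟩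
  · have hC := cos_pos_of_angle_lt c.rightHalf_angle_lt
    have hangle : c.rightHalf.angle / 2 = c.angle / 4 := by
      change c.angle / 2 / 2 = _
      ring
    rw [hangle] at hC
    have h1 : 0 < 3 / Real.cos (c.angle / 4) := by positivity
    have h2 : 0 ≤ 5 / Real.sin (c.angle / 4) ^ 2 := by positivity
    unfold admissibleBound at hn
    linarith
  · exact c.mem_region_of_dist_le hn hd (by rw [dist_self]; norm_num)
  · exact c.mem_region_of_dist_le hn hd d.dist_rightLeg

end Cone

end DoubleSemion

end

/-! ### The fusion rules for cones -/

theorem mainTheorem10 (ω : DoubleSemion.PosFunctional)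
    (hω : DoubleSemion.IsDoubleSemionState ω) (Λ : DoubleSemion.Cone) :
    (∃ n₀ : ℝ, ∀ n ≥ n₀, Λ.Admissible n) ∧
    ∀ n : ℝ, Λ.Admissible n →
      ∃ Ω : DoubleSemion.Anyon → DoubleSemion.Anyon → unitary (ω.GNS →L[ℂ] ω.GNS),
        ∀ a b, (Ω a b : ω.GNS →L[ℂ] ω.GNS) ∈ DoubleSemion.vonNeumann ω Λ.sites ∧
          ∀ O : DoubleSemion.QLoc,
            (Ω a b : ω.GNS →L[ℂ] ω.GNS) *
                ω.gnsStarAlgHom (DoubleSemion.coneAut Λ n a (DoubleSemion.coneAut Λ n b O)) *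
                star (Ω a b : ω.GNS →L[ℂ] ω.GNS) =
              ω.gnsStarAlgHom (DoubleSemion.coneAut Λ n (a * b) O) := by
  refine ⟨⟨Λ.admissibleBound, fun n hn => Λ.admissible_of_bound_le hn⟩, fun n hn => ?_⟩
  have hP := Λ.rightHalf.leftPath_subset n
  -- For an arbitrary admissible `n`, the location of the path is read off from the support of the
  -- semion string.
  have hS := hn.2 .semion
  exact DoubleSemion.exists_fusion_unitaries hω hP
    (DoubleSemion.Cone.finite_ends Λ.rightHalf_angle_lt n)
    (fun d hd => DoubleSemion.edge_mem_of_supportedIn hP hS hd)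
    fun d hd hl => DoubleSemion.rightLeg_mem_of_supportedIn hP hS hd hl
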